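/- \textbf{Theorem.} $\mathrm{QCMA}_{\mathrm{SBQP}}=\mathrm{QMA}_{\mathrm{SBQP}}=\mathrm{SBQP}$. Here a language is a set $L\subseteq\{0,1\}^*$. Quantum circuits are unitary circuits over the Clifford$+T$ gate set $\{H,T,\mathrm{CNOT}\}$ (with $X$, $T^{-1}$ and the Toffoli gate allowed as further elementary gates). A family $\{Q_x\}_{x\in\{0,1\}^*}$ is a uniform family of polynomial-size circuits if some Turing machine computes a description of $Q_x$ from $x$ in time polynomial in $|x|$. The probability $P_{Q(\rho)}(o=1)$ is the probability that a computational-basis measurement of a fixed output qubit gives $1$ after $Q$ has been run on the state $\rho$. States may be mixed (density matrices). Polynomials have coefficients in $\mathbb{N}$. Write $n=|x|$. \begin{itemize} \item $L\in\mathrm{SBQP}$ iff there are polynomials $m,r$ and a uniform family $\{Q_x\}_x$ of polynomial-size circuits, with $Q_x$ acting on $m(n)$ qubits initialized in $|0\rangle^{\otimes m(n)}$, such that for every $x$: if $x\in L$, then $Q_x$ accepts (outputs $o=1$) with probability at least $2^{-r(n)}$; if $x\notin L$, then $Q_x$ accepts with probability at most $2^{-r(n)-1}$. \item $L\in\mathrm{QMA}_{\mathrm{SBQP}}$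 iff there are polynomials $w,m,r$ and a uniform family $\{Q_x\}_x$ of polynomial-size circuits, where $Q_x$ takes as input a $w(n)$-qubit state $\xi$ (the witness) and $m(n)$ ancilla qubits initialized in $|0\rangle$, such that for every $x$: if $x\in L$, there is a $w(n)$-qubit state $\psi$ with $P_{Q_x(\psi)}(o=1)\ge 2^{-r(n)}$; if $x\notin L$, then $P_{Q_x(\xi)}(o=1)\le 2^{-r(n)-1}$ for every $w(n)$-qubit state $\xi$. \item $\mathrm{QCMA}_{\mathrm{SBQP}}$ is defined like $\mathrm{QMA}_{\mathrm{SBQP}}$, except that the witness is a classical bit string $y\in\{0,1\}^{w(n)}$, given to $Q_x$ as the basis state $|y\rangle$ (in both the case $x\in L$ and the case $x\notin L$). \end{itemize} -/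

import Mathlib

namespace SBQPMerlin

open scoped ComplexOrder

/-! ### Quantum circuits

The computational basis of an `N`-qubit register is indexed by `Fin N → Bool`. Circuits are lists of
gates over the Clifford + `T` gate set; `X`, `T⁻¹` and the Toffoli gate, which are exact products of
`H`, `T` and `CNOT`, are available as gates as well. -/

/-- The gates on `N` qubits. -/
inductive Gate (N : ℕ) : Type where
  /-- Pauli `X` (NOT) on qubit `t` -/
  | pauliX (t : Fin N)
  /-- the Hadamard gate on qubit `t` -/
  | hadamard (t : Fin N)
  /-- the phase gate `T = diag(1, exp(iπ/4))` on qubit `t` -/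
  | tGate (t : Fin N)
  /-- the inverse of the `T` gate on qubit `t` -/
  | tInv (t : Fin N)
  /-- controlled NOT with control `c` and target `t` -/
  | cnot (c t : Fin N) (hct : c ≠ t)
  /-- Toffoli gate with controls `a`, `b` and target `t` -/
  | toffoli (a b t : Fin N) (hab : a ≠ b) (hat : a ≠ t) (hbt : b ≠ t)

/-- Operators on an `N`-qubit register, as matrices in the computational basis. -/
abbrev Op (N : ℕ) : Type := Matrix (Fin N → Bool) (Fin N → Bool) ℂ

/-- The single-qubit operator `A` acting on qubit `t`, and the identity acting on the others. -/
noncomputable def onQubit {N : ℕ} (A : Matrix Bool Bool ℂ) (t : Fin N) : Op N :=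
  Matrix.of fun i j => if ∀ p, p ≠ t → i p = j p then A (i t) (j t) else 0

/-- The classical gate that flips qubit `t` of the basis state `j` when `f j` is true. -/
noncomputable def controlledFlip {N : ℕ} (f : (Fin N → Bool) → Bool) (t : Fin N) : Op N :=
  Matrix.of fun i j => if i = Function.update j t (xor (j t) (f j)) then 1 else 0

/-- The Hadamard matrix. -/
noncomputable def hadamardMatrix : Matrix Bool Bool ℂ :=
  Matrix.of fun a b => (if a && b then -1 else 1) / ((Real.sqrt 2 : ℝ) : ℂ)

/-- The matrix `diag(1, z)`. -/
noncomputable def phaseMatrix (z : ℂ) : Matrix Bool Bool ℂ :=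
  Matrix.diagonal fun a => if a then z else 1

/-- The unitary matrix of a gate. -/
noncomputable def Gate.toOp {N : ℕ} : Gate N → Op N
  | .pauliX t => controlledFlip (fun _ => true) t
  | .hadamard t => onQubit hadamardMatrix t
  | .tGate t => onQubit (phaseMatrix (Complex.exp (Complex.I * Real.pi / 4))) t
  | .tInv t => onQubit (phaseMatrix (Complex.exp (-(Complex.I * Real.pi / 4)))) t
  | .cnot c t _ => controlledFlip (fun j => j c) t
  | .toffoli a b t _ _ _ => controlledFlip (fun j => j a && j b) t

/-- A circuit on `N` qubits: the list of its gates, the gate at the head being applied first. -/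
abbrev Circuit (N : ℕ) : Type := List (Gate N)

/-- The unitary matrix of a circuit. -/
noncomputable def Circuit.toOp {N : ℕ} : Circuit N → Op N
  | [] => 1
  | g :: C => Circuit.toOp C * g.toOp

/-- The value of the output qubit, which is qubit `0`, in a basis state. A register without qubits
counts as output `0`. -/
def outputBit {N : ℕ} (i : Fin N → Bool) : Bool :=
  if h : 0 < N then i ⟨0, h⟩ else false

/-- The projection onto the states whose output qubit is `1`. -/
noncomputable def acceptProj (N : ℕ) : Op N :=
  Matrix.diagonal fun i => if outputBit i then 1 else 0

/-- The probability that the output qubit is measured to be `1` after the circuit `C` has been run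
on the state `ρ`. -/
noncomputable def acceptProb {N : ℕ} (C : Circuit N) (ρ : Op N) : ℝ :=
  (Matrix.trace (acceptProj N * (Circuit.toOp C * ρ * (Circuit.toOp C).conjTranspose))).re

/-! ### States -/

/-- `ρ` is a (possibly mixed) quantum state of `N` qubits: a density matrix. -/
def IsState {N : ℕ} (ρ : Op N) : Prop :=
  ρ.PosSemidef ∧ ρ.trace = 1

/-- The computational basis state `|y⟩⟨y|`. -/
noncomputable def basisState {N : ℕ} (y : Fin N → Bool) : Op N :=
  Matrix.single y y 1

/-- The state `|0…0⟩⟨0…0|`. -/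
noncomputable def zeroState (N : ℕ) : Op N :=
  basisState fun _ => false

/-- The product state `ρ ⊗ σ` of a `w`-qubit register (the first `w` qubits) and an `m`-qubit
register (the last `m` qubits). -/
noncomputable def tensor {w m : ℕ} (ρ : Op w) (σ : Op m) : Op (w + m) :=
  Matrix.of fun i j =>
    ρ (fun p => i (Fin.castAdd m p)) (fun p => j (Fin.castAdd m p)) *
      σ (fun p => i (Fin.natAdd w p)) (fun p => j (Fin.natAdd w p))

/-! ### Uniform families -/

/-- The alphabet in which circuits are written down. -/
inductive Symbol : Type where
  | pauliX | hadamard | tGate | tInv | cnot | toffoli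
  /-- the unit of the unary notation for the number of a qubit -/
  | tick
  /-- the end of the number of a qubit -/
  | sep
  deriving DecidableEq

/-- The number of a qubit in unary notation. -/
def encodeQubit {N : ℕ} (q : Fin N) : List Symbol :=
  List.replicate q.val Symbol.tick ++ [Symbol.sep]

/-- The description of a gate: its name, followed by the numbers of its qubits. -/
def Gate.encode {N : ℕ} : Gate N → List Symbol
  | .pauliX t => Symbol.pauliX :: encodeQubit t
  | .hadamard t => Symbol.hadamard :: encodeQubit t
  | .tGate t => Symbol.tGate :: encodeQubit t
  | .tInv t => Symbol.tInv :: encodeQubit t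
  | .cnot c t _ => Symbol.cnot :: (encodeQubit c ++ encodeQubit t)
  | .toffoli a b t _ _ _ =>
      Symbol.toffoli :: (encodeQubit a ++ encodeQubit b ++ encodeQubit t)

/-- The description of a circuit: the descriptions of its gates one after the other. -/
def Circuit.encode {N : ℕ} (C : Circuit N) : List Symbol :=
  List.flatMap Gate.encode C

/-- The family of circuits `Q x` on `N |x|` qubits, one for every instance `x`, is uniform: a Turing
machine computes the description of `Q x` from `x` in time polynomial in `|x|`. In particular `Q x`
has polynomially many gates. -/
def Uniform {N : ℕ → ℕ} (Q : ∀ x : List Bool, Circuit (N x.length)) : Prop :=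
  Nonempty (Turing.TM2ComputableInPolyTime (id : List Bool → List Bool)
    (id : List Symbol → List Symbol) fun x => Circuit.encode (Q x))

/-! ### The complexity classes -/

/-- The class SBQP. The circuit `Q x` starts in the state `|0…0⟩` of `m(|x|)` qubits. -/
def SBQP : Set (Language Bool) :=
  {L | ∃ (m r : Polynomial ℕ) (Q : ∀ x : List Bool, Circuit (m.eval x.length)),
    Uniform (N := fun n => m.eval n) Q ∧
    ∀ x : List Bool,
      (x ∈ L → (1 / 2 : ℝ) ^ r.eval x.length ≤ acceptProb (Q x) (zeroState _)) ∧
      (x ∉ L → acceptProb (Q x) (zeroState _) ≤ (1 / 2 : ℝ) ^ (r.eval x.length + 1))}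

/-- The class QMA_SBQP. The circuit `Q x` takes a `w(|x|)`-qubit witness state and `m(|x|)` ancilla
qubits in the state `|0…0⟩`. -/
def QMA_SBQP : Set (Language Bool) :=
  {L | ∃ (w m r : Polynomial ℕ)
      (Q : ∀ x : List Bool, Circuit (w.eval x.length + m.eval x.length)),
    Uniform (N := fun n => w.eval n + m.eval n) Q ∧
    ∀ x : List Bool,
      (x ∈ L → ∃ ψ : Op (w.eval x.length), IsState ψ ∧
        (1 / 2 : ℝ) ^ r.eval x.length ≤ acceptProb (Q x) (tensor ψ (zeroState _))) ∧
      (x ∉ L → ∀ ξ : Op (w.eval x.length), IsState ξ →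
        acceptProb (Q x) (tensor ξ (zeroState _)) ≤ (1 / 2 : ℝ) ^ (r.eval x.length + 1))}

/-- The class QCMA_SBQP: as QMA_SBQP, but the witness is a classical string of `w(|x|)` bits. -/
def QCMA_SBQP : Set (Language Bool) :=
  {L | ∃ (w m r : Polynomial ℕ)
      (Q : ∀ x : List Bool, Circuit (w.eval x.length + m.eval x.length)),
    Uniform (N := fun n => w.eval n + m.eval n) Q ∧
    ∀ x : List Bool,
      (x ∈ L → ∃ y : Fin (w.eval x.length) → Bool,
        (1 / 2 : ℝ) ^ r.eval x.length ≤
          acceptProb (Q x) (tensor (basisState y) (zeroState _))) ∧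
      (x ∉ L → ∀ y : Fin (w.eval x.length) → Bool,
        acceptProb (Q x) (tensor (basisState y) (zeroState _)) ≤
          (1 / 2 : ℝ) ^ (r.eval x.length + 1))}

end SBQPMerlin

namespace SBQPMerlin

open Turing Function

/-! ### Programs for stack machines -/

/-! For a verifier `C` on `w` witness qubits let A = `acceptOp w C`, the positive semidefinite
operator with acceptance probability tr(Aξ) on the witness ξ. All three inclusions are statements
about A.

SBQP lies in QCMA_SBQP by taking an empty witness. For QCMA_SBQP ⊆ QMA_SBQP the verifier first
copies the witness by CNOTs into a register that is not touched again. This dephases the witness and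
replaces A by its diagonal (`acceptOp_copyWitness`), so every quantum witness is accepted with a
convex combination of the probabilities of the classical strings.

QMA_SBQP ⊆ SBQP is in-place amplification in the style of Marriott and Watrous, with the maximally
mixed state as witness. One round runs `C`, checks the output qubit, runs the inverse of `C` and
checks that the ancillas are back at 0; if all checks succeed, the witness has been multiplied by A.
After w + 1 rounds, all checks have succeeded with probability 2^(-w) tr(A^(2(w+1)))
(`acceptProb_amplify`). On a yes-instance A has an eigenvalue at least 2^(-r), which makes this at
least 2^(-w-2r(w+1)). On a no-instance all of the 2^w eigenvalues are at most 2^(-r-1), and the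
power 2(w+1) outweighs the number of eigenvalues (`pow_le_re_trace_pow`, `re_trace_pow_le`).

Uniformity requires an actual Turing machine for each new family. Structured programs `Prog` are
therefore compiled to stack machines, with the machine of the given family as a subroutine. They
evaluate the polynomials in unary and write the new descriptions in polynomial time
(`nonempty_computable_of_prog`, `uniform_of_strPairs`, `uniform_of_strAmplify`). -/

instance : Fintype Symbol where
  elems := {.pauliX, .hadamard, .tGate, .tInv, .cnot, .toffoli, .tick, .sep}
  complete s := by cases s <;> simp

/-- `n` steps of the machine `M` lead from `c` to `c'`. -/
def StepsIn {K : Type} [DecidableEq K] {Γ : K → Type} {Λ σ : Type} (M : Λ → TM2.Stmt Γ Λ σ)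
    (n : ℕ) (c c' : TM2.Cfg Γ Λ σ) : Prop :=
  (flip bind (TM2.step M))^[n] (some c) = some c'

section StepsIn

variable {K : Type} [DecidableEq K] {Γ : K → Type} {Λ σ : Type} {M : Λ → TM2.Stmt Γ Λ σ}

theorem StepsIn.refl (c : TM2.Cfg Γ Λ σ) : StepsIn M 0 c c := rfl

theorem StepsIn.trans {m n : ℕ} {a b c : TM2.Cfg Γ Λ σ} (h₁ : StepsIn M m a b)
    (h₂ : StepsIn M n b c) : StepsIn M (m + n) a c := by
  unfold StepsIn at *
  rw [add_comm, iterate_add_apply, h₁, h₂]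

theorem StepsIn.one {a b : TM2.Cfg Γ Λ σ} (h : TM2.step M a = some b) : StepsIn M 1 a b := h

theorem iterate_bind_none (n : ℕ) :
    (flip bind (TM2.step M))^[n] (none : Option (TM2.Cfg Γ Λ σ)) = none := by
  induction n with
  | zero => rfl
  | succ n ih => rw [iterate_succ_apply]; exact ih

theorem StepsIn.succ_elim {n : ℕ} {a c : TM2.Cfg Γ Λ σ} (h : StepsIn M (n + 1) a c) :
    ∃ b, TM2.step M a = some b ∧ StepsIn M n b c := by
  unfold StepsIn at h
  rw [iterate_succ_apply] at h
  have e : flip bind (TM2.step M) (some a) = TM2.step M a := rfl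
  rw [e] at h
  cases hb : TM2.step M a with
  | none => rw [hb, iterate_bind_none] at h; cases h
  | some b => exact ⟨b, rfl, by rw [hb] at h; exact h⟩

end StepsIn

/-- The working stacks of a program: the output, three stacks for descriptions of circuits, and
unary counters. -/
inductive Reg : Type where
  | out | rev | dir | blk | inp | n | w | m | k | q | c | e | t₁ | t₂ | wl | ml | kl
  deriving DecidableEq

instance : Fintype Reg where
  elems := {.out, .rev, .dir, .blk, .inp, .n, .w, .m, .k, .q, .c, .e, .t₁, .t₂, .wl, .ml, .kl}
  complete s := by cases s <;> simp

/-- The stack alphabets of the machine `tm` with the working stacks added. -/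
def Alph (tm : FinTM2) : tm.K ⊕ Reg → Type
  | .inl k => tm.Γ k
  | .inr _ => Symbol

/-- The contents of all stacks. -/
abbrev Stacks (tm : FinTM2) : Type := ∀ k, List (Alph tm k)

/-- Programs that use the machine `tm` as a subroutine. -/
inductive Prog (tm : FinTM2) : Type where
  | skip
  | push (k : tm.K ⊕ Reg) (a : Alph tm k)
  | seq (p q : Prog tm)
  /-- pop the symbols of the stack `k` until it is empty, running `body` on each of them -/
  | forPop (k : tm.K ⊕ Reg) (rd : Alph tm k → Symbol) (body : Symbol → Prog tm)
  /-- run `tm` -/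
  | call

namespace Prog

variable {tm : FinTM2}

/-- The labels of a program. -/
def Lab : Prog tm → Type
  | skip => Unit
  | push _ _ => Unit
  | seq p q => Lab p ⊕ Lab q
  | forPop _ _ body => Option (Σ s, Lab (body s))
  | call => tm.Λ

/-- The label at which a program starts. -/
def entry : (p : Prog tm) → p.Lab
  | skip => ()
  | push _ _ => ()
  | seq p _ => Sum.inl p.entry
  | forPop _ _ _ => (none : Option _)
  | call => tm.main

theorem finite_lab (p : Prog tm) : Finite p.Lab := by
  induction p with
  | skip => exact inferInstanceAs (Finite Unit)
  | push => exact inferInstanceAs (Finite Unit)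
  | seq p q hp hq =>
    have := hp; have := hq
    exact inferInstanceAs (Finite (p.Lab ⊕ q.Lab))
  | forPop k rd body h =>
    have := h
    exact inferInstanceAs (Finite (Option (Σ s, (body s).Lab)))
  | call => exact @Finite.of_fintype _ tm.ΛFin

/-- A statement of `tm` as a statement of a larger machine, which jumps to `x` where `tm` halts. -/
def liftStmt {Λ : Type} (e : tm.Λ → Λ) (x : Λ) :
    TM2.Stmt tm.Γ tm.Λ tm.σ → TM2.Stmt (Alph tm) Λ (tm.σ × Option Symbol)
  | .push k f q => .push (Sum.inl k) (fun v => f v.1) (liftStmt e x q)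
  | .peek k f q => .peek (Sum.inl k) (fun v o => (f v.1 o, v.2)) (liftStmt e x q)
  | .pop k f q => .pop (Sum.inl k) (fun v o => (f v.1 o, v.2)) (liftStmt e x q)
  | .load f q => .load (fun v => (f v.1, v.2)) (liftStmt e x q)
  | .branch f q₁ q₂ => .branch (fun v => f v.1) (liftStmt e x q₁) (liftStmt e x q₂)
  | .goto f => .goto fun v => e (f v.1)
  | .halt => .goto fun _ => x

/-- The machine code of a program, with its labels placed by `e` and the exit `x`. -/
def code : (p : Prog tm) → {Λ : Type} → (p.Lab → Λ) → Λ → p.Lab →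
    TM2.Stmt (Alph tm) Λ (tm.σ × Option Symbol)
  | skip, _, _, x, _ => .goto fun _ => x
  | push k a, _, _, x, _ => .push k (fun _ => a) (.goto fun _ => x)
  | seq p q, _, e, _, Sum.inl l => p.code (fun l => e (Sum.inl l)) (e (Sum.inr q.entry)) l
  | seq _ q, _, e, x, Sum.inr l => q.code (fun l => e (Sum.inr l)) x l
  | forPop k rd body, _, e, x, none =>
    .pop k (fun v o => (v.1, o.map rd)) (.goto fun v => match v.2 with
      | none => x
      | some s => e (some ⟨s, (body s).entry⟩))
  | forPop _ _ body, _, e, _, some ⟨s, l⟩ =>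
    (body s).code (fun l => e (some ⟨s, l⟩)) (e none) l
  | call, _, e, x, l => liftStmt e x (tm.m l)

/-- Started with the stacks `S`, the program `p` ends with the stacks `S'` after at most `t`
steps. -/
def Within (p : Prog tm) (S S' : Stacks tm) (t : ℕ) : Prop :=
  ∀ (Λ : Type) (M : Λ → TM2.Stmt (Alph tm) Λ (tm.σ × Option Symbol)) (e : p.Lab → Λ) (x : Λ),
    (∀ l, M (e l) = p.code e x l) → ∀ b, ∃ b' n, n ≤ t ∧
      StepsIn M n ⟨some (e p.entry), (tm.initialState, b), S⟩ ⟨some x, (tm.initialState, b'), S'⟩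

variable {p q : Prog tm} {S S' S'' : Stacks tm} {t t' : ℕ}

theorem Within.mono (h : p.Within S S' t) (ht : t ≤ t') : p.Within S S' t' := by
  intro Λ M e x hM b
  obtain ⟨b', n, hn, H⟩ := h Λ M e x hM b
  exact ⟨b', n, hn.trans ht, H⟩

theorem within_skip : (skip : Prog tm).Within S S 1 := by
  intro Λ M e x hM b
  refine ⟨b, 1, le_rfl, StepsIn.one ?_⟩
  simp [hM, code]

theorem within_push (k : tm.K ⊕ Reg) (a : Alph tm k) :
    (push k a).Within S (update S k (a :: S k)) 1 := by
  intro Λ M e x hM b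
  refine ⟨b, 1, le_rfl, StepsIn.one ?_⟩
  simp [hM, code]

theorem Within.seq (hp : p.Within S S' t) (hq : q.Within S' S'' t') :
    (seq p q).Within S S'' (t + t') := by
  intro Λ M e x hM b
  obtain ⟨b₁, n₁, hn₁, H₁⟩ := hp Λ M (fun l => e (Sum.inl l)) (e (Sum.inr q.entry))
    (fun l => hM (Sum.inl l)) b
  obtain ⟨b₂, n₂, hn₂, H₂⟩ := hq Λ M (fun l => e (Sum.inr l)) x (fun l => hM (Sum.inr l)) b₁
  exact ⟨b₂, n₁ + n₂, by omega, H₁.trans H₂⟩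

theorem within_forPop_nil {k : tm.K ⊕ Reg} {rd : Alph tm k → Symbol} {body : Symbol → Prog tm}
    (h : S k = []) : (forPop k rd body).Within S S 1 := by
  intro Λ M e x hM b
  refine ⟨none, 1, le_rfl, StepsIn.one ?_⟩
  have : M (e (forPop k rd body).entry) = _ := hM none
  simp only [TM2.step, this, code, TM2.stepAux, h]
  congr 2
  -- Popping an empty stack stores its tail, which is again empty, so the stacks are unchanged.
  rw [List.tail_nil, ← h, update_eq_self]

theorem within_forPop_cons {k : tm.K ⊕ Reg} {rd : Alph tm k → Symbol} {body : Symbol → Prog tm}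
    {a : Alph tm k} {l : List (Alph tm k)} (h : S k = a :: l)
    (h₁ : (body (rd a)).Within (update S k l) S' t)
    (h₂ : (forPop k rd body).Within S' S'' t') :
    (forPop k rd body).Within S S'' (t + t' + 1) := by
  intro Λ M e x hM b
  obtain ⟨b₁, n₁, hn₁, H₁⟩ := h₁ Λ M (fun l => e (some ⟨rd a, l⟩)) (e none)
    (fun l => hM (some ⟨rd a, l⟩)) (some (rd a))
  obtain ⟨b₂, n₂, hn₂, H₂⟩ := h₂ Λ M e x hM b₁
  refine ⟨b₂, 1 + n₁ + n₂, by omega, (StepsIn.trans (StepsIn.one ?_) H₁).trans H₂⟩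
  have : M (e (forPop k rd body).entry) = _ := hM none
  simp [this, code, h]

/-- The stacks of `tm` together with the working stacks. -/
def join (S : ∀ k, List (tm.Γ k)) (T : Reg → List Symbol) : Stacks tm
  | .inl k => S k
  | .inr r => T r

theorem update_join_inl (S : ∀ k, List (tm.Γ k)) (T : Reg → List Symbol) (k : tm.K)
    (l : List (tm.Γ k)) :
    update (join S T) (Sum.inl k) l = join (update S k l) T := by
  funext j
  rcases j with j | r
  · by_cases hj : j = k
    · subst hj
      exact (update_self (Sum.inl j) l (join S T)).trans (update_self j l S).symm
    · exact (update_of_ne (β := fun k => List (Alph tm k)) (mt (@Sum.inl.inj _ _ _ _) hj) l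
        (join S T)).trans (show S j = update S k l j from (update_of_ne hj l S).symm)
  · exact update_of_ne Sum.inr_ne_inl l (join S T)

theorem update_join_inr (S : ∀ k, List (tm.Γ k)) (T : Reg → List Symbol) (r : Reg)
    (l : List Symbol) :
    update (join S T) (Sum.inr r) l = join S (update T r l) := by
  funext j
  rcases j with j | j
  · exact update_of_ne Sum.inl_ne_inr l (join S T)
  · by_cases hj : j = r
    · subst hj
      exact (update_self (Sum.inr j) l (join S T)).trans (update_self j l T).symm
    · exact (update_of_ne (β := fun k => List (Alph tm k)) (mt (@Sum.inr.inj _ _ _ _) hj) l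
        (join S T)).trans (show T j = update T r l j from (update_of_ne hj l T).symm)

/-- The configuration of a larger machine while it runs `tm`. -/
def liftCfg {Λ : Type} (e : tm.Λ → Λ) (x : Λ) (b : Option Symbol) (T : Reg → List Symbol)
    (c : TM2.Cfg tm.Γ tm.Λ tm.σ) : TM2.Cfg (Alph tm) Λ (tm.σ × Option Symbol) where
  l := some (c.l.elim x e)
  var := (c.var, b)
  stk := join c.stk T

/-- A lifted statement touches only the stacks of `tm` and the first component of the state. Halting
has become a jump to `x`, which is why `liftCfg` sends the label `none` to `x`. -/
theorem stepAux_liftStmt {Λ : Type} (e : tm.Λ → Λ) (x : Λ) (b : Option Symbol)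
    (T : Reg → List Symbol) (s : TM2.Stmt tm.Γ tm.Λ tm.σ) (v : tm.σ) (S : ∀ k, List (tm.Γ k)) :
    TM2.stepAux (liftStmt e x s) (v, b) (join S T) = liftCfg e x b T (TM2.stepAux s v S) := by
  induction s generalizing v S with
  | push k f q ih =>
    exact (congrArg _ (update_join_inl S T k (f v :: S k))).trans (ih _ _)
  | peek k f q ih => exact ih _ _
  | pop k f q ih =>
    exact (congrArg _ (update_join_inl S T k (S k).tail)).trans (ih _ _)
  | load f q ih => exact ih _ _
  | branch f q₁ q₂ ih₁ ih₂ =>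
    simp only [liftStmt, TM2.stepAux]
    cases f v
    · exact ih₂ v S
    · exact ih₁ v S
  | goto f => rfl
  | halt => rfl

theorem stepsIn_liftCfg {Λ : Type} {M : Λ → TM2.Stmt (Alph tm) Λ (tm.σ × Option Symbol)}
    {e : tm.Λ → Λ} {x : Λ} (hM : ∀ l, M (e l) = liftStmt e x (tm.m l)) (b : Option Symbol)
    (T : Reg → List Symbol) {n : ℕ} {c c' : TM2.Cfg tm.Γ tm.Λ tm.σ} (h : StepsIn tm.m n c c') :
    StepsIn M n (liftCfg e x b T c) (liftCfg e x b T c') := by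
  induction n generalizing c with
  | zero =>
    have : c = c' := by simpa [StepsIn] using h
    subst this; exact StepsIn.refl _
  | succ n ih =>
    obtain ⟨d, hd, hn⟩ := h.succ_elim
    rw [add_comm]
    refine StepsIn.trans (StepsIn.one ?_) (ih hn)
    obtain ⟨l, v, S⟩ := c
    cases l with
    | none => simp at hd
    | some l =>
      simp only [TM2.step, Option.some.injEq] at hd
      subst hd
      rw [← stepAux_liftStmt]
      simp only [liftCfg, TM2.step, Option.elim, hM]

/-- Both `initList` and `haltList` carry the initial state of `tm`. This is the reason why `Within`
fixes that state at both ends of every program. -/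
theorem within_call {l : List (tm.Γ tm.k₀)} {l' : List (tm.Γ tm.k₁)} {T : Reg → List Symbol}
    (h : StateTransition.EvalsToInTime tm.step (initList tm l) (some (haltList tm l')) t) :
    (call : Prog tm).Within (join (initList tm l).stk T) (join (haltList tm l').stk T) t := by
  intro Λ M e x hM b
  refine ⟨b, h.steps, h.steps_le_m, ?_⟩
  exact stepsIn_liftCfg hM b T (c := initList tm l) (c' := haltList tm l') h.evals_in_steps

end Prog

end SBQPMerlin

/-! ### Loops and unary arithmetic on the working stacks. -/

namespace SBQPMerlin

open Turing Function

/-- The unary notation for `n`, without end mark. -/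
abbrev ticks (n : ℕ) : List Symbol := List.replicate n Symbol.tick

/-- The unary notation for `n`, with end mark. -/
abbrev num (n : ℕ) : List Symbol := ticks n ++ [Symbol.sep]

theorem ticks_succ (n : ℕ) : ticks (n + 1) = Symbol.tick :: ticks n := rfl

namespace Prog

variable {tm : FinTM2}

/-! ### Programs that only use the working stacks -/

/-- Started with the working stacks `T` and the stacks of `tm` empty, the program `p` ends with the
working stacks `T'` and the stacks of `tm` empty after at most `t` steps. -/
def Aux (p : Prog tm) (T T' : Reg → List Symbol) (t : ℕ) : Prop :=
  p.Within (join (fun _ => []) T) (join (fun _ => []) T') t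

/-- Push the symbol `s` on the stack `r`. -/
def put (r : Reg) (s : Symbol) : Prog tm := push (Sum.inr r) s

/-- Empty the stack `r`, running `body` on its symbols. -/
def loop (r : Reg) (body : Symbol → Prog tm) : Prog tm := forPop (Sum.inr r) id body

/-- Run `body` once for each symbol on the stack `r`, using the empty stack `r'` to restore `r`. -/
def rep (r r' : Reg) (body : Prog tm) : Prog tm :=
  seq (loop r fun s => seq body (put r' s)) (loop r' fun s => put r s)

variable {p q : Prog tm} {T T' T'' : Reg → List Symbol} {t t' : ℕ}

theorem Aux.mono (h : p.Aux T T' t) (ht : t ≤ t') : p.Aux T T' t' := Within.mono h ht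

theorem Aux.congr {U U' : Reg → List Symbol} (h : p.Aux T T' t) (h₁ : T = U) (h₂ : T' = U')
    (ht : t ≤ t') : p.Aux U U' t' := by
  subst h₁ h₂; exact h.mono ht

theorem Aux.seq (hp : p.Aux T T' t) (hq : q.Aux T' T'' t') : (seq p q).Aux T T'' (t + t') :=
  Within.seq hp hq

theorem aux_skip : (skip : Prog tm).Aux T T 1 := within_skip

theorem aux_put (r : Reg) (s : Symbol) : (put r s : Prog tm).Aux T (update T r (s :: T r)) 1 := by
  have := within_push (S := join (fun _ => []) T) (Sum.inr r : tm.K ⊕ Reg) s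
  unfold Aux
  rw [← update_join_inr]
  exact this

theorem aux_loop_nil {r : Reg} {body : Symbol → Prog tm} (h : T r = []) :
    (loop r body).Aux T T 1 :=
  within_forPop_nil h

theorem aux_loop_cons {r : Reg} {body : Symbol → Prog tm} {s : Symbol} {l : List Symbol}
    (h : T r = s :: l) (h₁ : (body s).Aux (update T r l) T' t)
    (h₂ : (loop r body).Aux T' T'' t') : (loop r body).Aux T T'' (t + t' + 1) := by
  refine within_forPop_cons (k := Sum.inr r) (a := s) (l := l) h ?_ h₂
  unfold Aux at h₁
  rw [← update_join_inr] at h₁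
  exact h₁

/-- The loop invariant rule: `F i` describes the working stacks after `i` rounds, and the body
starts when the next symbol has already been popped. -/
theorem aux_loop {r : Reg} {body : Symbol → Prog tm} (l : List Symbol)
    (F : ℕ → Reg → List Symbol) (hl : ∀ i ≤ l.length, F i r = l.drop i)
    (h : ∀ i (hi : i < l.length),
      (body l[i]).Aux (update (F i) r (l.drop (i + 1))) (F (i + 1)) t) :
    (loop r body).Aux (F 0) (F l.length) (l.length * (t + 1) + 1) := by
  suffices H : ∀ j i, i + j = l.length →
      (loop r body).Aux (F i) (F l.length) (j * (t + 1) + 1) from H l.length 0 (by simp)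
  intro j
  induction j with
  | zero =>
    intro i hi
    obtain rfl : i = l.length := hi
    exact (aux_loop_nil (by rw [hl _ le_rfl, List.drop_length])).mono (by simp)
  | succ j ih =>
    intro i hi
    have hi' : i < l.length := by omega
    refine (aux_loop_cons (by rw [hl i hi'.le, List.drop_eq_getElem_cons hi']) (h i hi')
      (ih (i + 1) (by omega))).mono ?_
    rw [add_mul]; omega

theorem aux_move {r r' : Reg} (hr : r ≠ r') :
    (loop r (fun s => put r' s) : Prog tm).Aux T
      (update (update T r []) r' ((T r).reverse ++ T r')) (2 * (T r).length + 1) := by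
  generalize hl : T r = l
  induction l generalizing T with
  | nil =>
    refine (aux_loop_nil hl).congr rfl ?_ le_rfl
    funext x
    by_cases h₁ : x = r' <;> by_cases h₂ : x = r <;> simp_all
  | cons s l ih =>
    refine (aux_loop_cons hl (aux_put r' s) (ih ?_)).congr rfl ?_ (by simp; omega)
    · simp [hr]
    · funext x
      by_cases h₁ : x = r' <;> by_cases h₂ : x = r <;> simp_all

theorem aux_clear (r : Reg) :
    (loop r (fun _ => skip) : Prog tm).Aux T (update T r []) (2 * (T r).length + 1) := by
  generalize hl : T r = l
  induction l generalizing T with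
  | nil => exact (aux_loop_nil hl).congr rfl (by rw [← hl, update_eq_self]) (by simp)
  | cons s l ih =>
    refine (aux_loop_cons hl aux_skip (ih (by simp))).congr rfl (by simp) (by simp; omega)

/-- During the loop the counter is split between `r` and `r'`, so the body has to work for arbitrary
contents `a`, `b` of these two stacks. -/
theorem aux_rep {r r' : Reg} (hr : r ≠ r') {body : Prog tm} {n : ℕ}
    (F : ℕ → Reg → List Symbol) (h₀ : F 0 r = ticks n) (h₀' : F 0 r' = [])
    (h₁ : F n r = ticks n) (h₁' : F n r' = [])
    (h : ∀ i < n, ∀ a b, body.Aux (update (update (F i) r a) r' b)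
      (update (update (F (i + 1)) r a) r' b) t) :
    (rep r r' body).Aux (F 0) (F n) (n * (t + 4) + 2) := by
  have hl := aux_loop (tm := tm) (r := r) (body := fun s => seq body (put r' s)) (t := t + 1)
    (ticks n) (fun i => update (update (F i) r (ticks (n - i))) r' (ticks i)) (by simp [hr])
    (by
      intro i hi
      simp only [List.length_replicate] at hi
      have e : ticks (n - i) = Symbol.tick :: ticks (n - (i + 1)) := by
        rw [← ticks_succ]; congr 1; omega
      refine ((h i hi (ticks (n - (i + 1))) (ticks i)).seq (aux_put _ _)).congr ?_ ?_ le_rfl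
      · funext x
        by_cases h₁ : x = r' <;> by_cases h₂ : x = r <;> simp_all
      · funext x
        by_cases h₁ : x = r' <;> by_cases h₂ : x = r <;> simp_all [ticks_succ])
  simp only [List.length_replicate] at hl
  refine (hl.seq (aux_move hr.symm)).congr ?_ ?_ ?_
  · funext x
    by_cases h₁ : x = r' <;> by_cases h₂ : x = r <;> simp_all
  · funext x
    by_cases h₁ : x = r' <;> by_cases h₂ : x = r <;> simp_all
  · simp [mul_add]; omega

/-- `rep` with a body that pushes one tick on a third stack. -/
theorem aux_rep_put {r r' d : Reg} (hr : r ≠ r') (hd : d ≠ r) (hd' : d ≠ r') {n : ℕ}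
    (h₀ : T r = ticks n) (h₀' : T r' = []) :
    (rep r r' (put d .tick) : Prog tm).Aux T (update T d (ticks n ++ T d)) (n * 5 + 2) := by
  refine (aux_rep (tm := tm) (t := 1) hr (body := put d .tick) (n := n)
    (fun i => update T d (ticks i ++ T d)) (by simp [hd.symm, h₀]) (by simp [hd'.symm, h₀'])
    (by simp [hd.symm, h₀]) (by simp [hd'.symm, h₀'])
    (by
      intro i hi a b
      refine (aux_put d .tick).congr rfl ?_ le_rfl
      funext x
      by_cases h₁ : x = r' <;> by_cases h₂ : x = r <;> by_cases h₃ : x = d <;>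
        simp_all [ticks_succ])).congr (by simp) rfl le_rfl

/-! ### Polynomials in unary -/

/-- Push `c` ticks on the stack `d`. -/
def putTicks (d : Reg) : ℕ → Prog tm
  | 0 => skip
  | c + 1 => seq (putTicks d c) (put d .tick)

theorem aux_putTicks (d : Reg) (c : ℕ) :
    (putTicks d c : Prog tm).Aux T (update T d (ticks c ++ T d)) (c + 1) := by
  induction c with
  | zero => exact aux_skip.congr rfl (by simp) le_rfl
  | succ c ih =>
    exact (ih.seq (aux_put _ _)).congr rfl (by simp [ticks_succ]) (by omega)

/-- Multiply the unary number on the stack `d` by the one on the stack `n`. -/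
def mulN (d : Reg) : Prog tm :=
  seq (loop d fun s => put .t₁ s) (loop .t₁ fun _ => rep .n .t₂ (put d .tick))

/-- The ticks of `d` are moved to `t₁`, and each of them then adds a copy of the number on the stack
`n` to `d`. -/
theorem aux_mulN {d : Reg} (hn : d ≠ .n) (h₁ : d ≠ .t₁) (h₂ : d ≠ .t₂) {v n : ℕ}
    (hv : T d = ticks v) (hN : T .n = ticks n) (ht₁ : T .t₁ = []) (ht₂ : T .t₂ = []) :
    (mulN d : Prog tm).Aux T (update T d (ticks (v * n))) (v * (5 * n + 5) + 2) := by
  have hl := aux_loop (tm := tm) (r := .t₁) (body := fun _ => rep .n .t₂ (put d .tick))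
    (t := n * 5 + 2) (ticks v)
    (fun i => update (update T .t₁ (ticks (v - i))) d (ticks (i * n))) (by simp [h₁.symm])
    (by
      intro i hi
      refine (aux_rep_put (n := n) (by simp) hn h₂ ?_ ?_).congr rfl ?_ le_rfl
      · simp [hn.symm, hN]
      · simp [h₂.symm, ht₂]
      · funext x
        by_cases h₁ : x = .t₁ <;> by_cases h₂ : x = d <;>
          simp_all [add_mul, Nat.sub_add_eq, add_comm])
  simp only [List.length_replicate] at hl
  refine ((aux_move h₁).seq (hl.congr ?_ rfl le_rfl)).congr rfl ?_ ?_
  · funext x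
    by_cases h₁ : x = .t₁ <;> by_cases h₂ : x = d <;> simp_all
  · funext x
    by_cases h₁ : x = .t₁ <;> by_cases h₂ : x = d <;> simp_all
  · simp [hv]; ring_nf; omega

/-- The value at `n` of the polynomial with the coefficients `cs`. -/
def hornerVal : List ℕ → ℕ → ℕ
  | [], _ => 0
  | c :: cs, n => c + hornerVal cs n * n

/-- Evaluate the polynomial with the coefficients `cs`. -/
def horner (d : Reg) : List ℕ → Prog tm
  | [] => skip
  | c :: cs => seq (horner d cs) (seq (mulN d) (putTicks d c))

/-- The running time of `horner`. -/
def hornerTime : List ℕ → ℕ → ℕ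
  | [], _ => 1
  | c :: cs, n => hornerTime cs n + (hornerVal cs n * (5 * n + 5) + 2 + (c + 1))

theorem aux_horner {d : Reg} (hn : d ≠ .n) (h₁ : d ≠ .t₁) (h₂ : d ≠ .t₂) (cs : List ℕ) {n : ℕ}
    (hd : T d = []) (hN : T .n = ticks n) (ht₁ : T .t₁ = []) (ht₂ : T .t₂ = []) :
    (horner d cs : Prog tm).Aux T (update T d (ticks (hornerVal cs n))) (hornerTime cs n) := by
  induction cs with
  | nil => exact aux_skip.congr rfl (by simp [hornerVal, ← hd]) le_rfl
  | cons c cs ih =>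
    refine (ih.seq ((aux_mulN hn h₁ h₂ (by simp) (by simpa [hn.symm] using hN)
      (by simpa [h₁.symm] using ht₁) (by simpa [h₂.symm] using ht₂)).seq
      (aux_putTicks _ _))).congr rfl ?_ le_rfl
    simp [hornerVal]

theorem exists_hornerVal (p : Polynomial ℕ) : ∃ cs, ∀ n, hornerVal cs n = p.eval n := by
  induction p using Polynomial.recOnHorner with
  | M0 => exact ⟨[], by simp [hornerVal]⟩
  | MC p a _ _ ih =>
    obtain ⟨cs, h⟩ := ih
    cases cs with
    | nil => exact ⟨[a], fun n => by simp [hornerVal, ← h]⟩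
    | cons c cs => exact ⟨(c + a) :: cs, fun n => by simp [← h, hornerVal]; ring⟩
  | MX p _ ih =>
    obtain ⟨cs, h⟩ := ih
    exact ⟨0 :: cs, fun n => by simp [hornerVal, h]⟩

end Prog

end SBQPMerlin

/-! ### Output length, and the machine that wraps a program around a given machine. -/

namespace SBQPMerlin

open Turing Function

/-! ### The length of the output of a machine -/

/-- The number of `push` instructions in a statement. -/
def pushes {K : Type} {Γ : K → Type} {Λ σ : Type} : TM2.Stmt Γ Λ σ → ℕ
  | .push _ _ q => pushes q + 1
  | .peek _ _ q => pushes q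
  | .pop _ _ q => pushes q
  | .load _ q => pushes q
  | .branch _ q₁ q₂ => pushes q₁ + pushes q₂
  | .goto _ => 0
  | .halt => 0

theorem length_stepAux_le {K : Type} [DecidableEq K] {Γ : K → Type} {Λ σ : Type}
    (s : TM2.Stmt Γ Λ σ) (v : σ) (S : ∀ k, List (Γ k)) (k : K) :
    ((TM2.stepAux s v S).stk k).length ≤ (S k).length + pushes s := by
  induction s generalizing v S with
  | push j f q ih =>
    refine (ih _ _).trans ?_
    by_cases h : k = j
    · subst h; simp [pushes, add_assoc, add_comm 1]
    · simp [pushes, h]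
  | peek j f q ih => exact ih _ _
  | pop j f q ih =>
    refine (ih _ _).trans ?_
    by_cases h : k = j
    · subst h; simp [pushes]
    · simp [pushes, h]
  | load f q ih => exact ih _ _
  | branch f q₁ q₂ ih₁ ih₂ =>
    simp only [TM2.stepAux, pushes]
    cases f v
    · exact (ih₂ v S).trans (by omega)
    · exact (ih₁ v S).trans (by omega)
  | goto f => simp [pushes]
  | halt => simp [pushes]

theorem StepsIn.length_le {K : Type} [DecidableEq K] {Γ : K → Type} {Λ σ : Type}
    {M : Λ → TM2.Stmt Γ Λ σ} {b : ℕ} (hb : ∀ l, pushes (M l) ≤ b) {n : ℕ}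
    {c c' : TM2.Cfg Γ Λ σ} (h : StepsIn M n c c') (k : K) :
    (c'.stk k).length ≤ (c.stk k).length + n * b := by
  induction n generalizing c with
  | zero =>
    obtain rfl : c = c' := by simpa [StepsIn] using h
    simp
  | succ n ih =>
    obtain ⟨d, hd, hn⟩ := h.succ_elim
    obtain ⟨l, v, S⟩ := c
    cases l with
    | none => simp at hd
    | some l =>
      simp only [TM2.step, Option.some.injEq] at hd
      subst hd
      have h₁ := ih hn
      have h₂ := length_stepAux_le (M l) v S k
      have h₃ := hb l
      rw [add_mul]
      simp only at *
      omega

theorem initList_stk (tm : FinTM2) (l : List (tm.Γ tm.k₀)) :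
    (initList tm l).stk = update (fun _ => []) tm.k₀ l := by
  funext k
  by_cases h : k = tm.k₀
  · subst h; simp [initList]
  · simp [initList, h]

theorem haltList_stk (tm : FinTM2) (l : List (tm.Γ tm.k₁)) :
    (haltList tm l).stk = update (fun _ => []) tm.k₁ l := by
  funext k
  by_cases h : k = tm.k₁
  · subst h; simp [haltList]
  · simp [haltList, h]

/-- The functions that are bounded by a polynomial. -/
def PolyBdd (f : ℕ → ℕ) : Prop := ∃ p : Polynomial ℕ, ∀ n, f n ≤ p.eval n

namespace PolyBdd

variable {f g : ℕ → ℕ}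

theorem eval (p : Polynomial ℕ) : PolyBdd fun n => p.eval n := ⟨p, fun _ => le_rfl⟩

theorem const (c : ℕ) : PolyBdd fun _ => c := ⟨.C c, fun _ => by simp⟩

theorem id : PolyBdd fun n => n := ⟨.X, fun _ => by simp⟩

theorem add (hf : PolyBdd f) (hg : PolyBdd g) : PolyBdd fun n => f n + g n := by
  obtain ⟨p, hp⟩ := hf
  obtain ⟨q, hq⟩ := hg
  exact ⟨p + q, fun n => by simpa using add_le_add (hp n) (hq n)⟩

theorem mul (hf : PolyBdd f) (hg : PolyBdd g) : PolyBdd fun n => f n * g n := by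
  obtain ⟨p, hp⟩ := hf
  obtain ⟨q, hq⟩ := hg
  exact ⟨p * q, fun n => by simpa using Nat.mul_le_mul (hp n) (hq n)⟩

end PolyBdd

/-- One step pushes at most as many symbols as there are `push` instructions under all labels
together, so the running time bounds the output length. The bound is needed because programs that
process `f x` take time depending on its length. -/
theorem polyBdd_length {f : List Bool → List Symbol}
    (h : TM2ComputableInPolyTime (id : List Bool → List Bool) (id : List Symbol → List Symbol) f) :
    ∃ L, PolyBdd L ∧ ∀ x, (f x).length ≤ L x.length := by
  have := h.tm.ΛFin
  refine ⟨fun n => n + h.time.eval n * ∑ l, pushes (h.tm.m l),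
    .add .id (.mul (.eval _) (.const _)), fun x => ?_⟩
  have hx := h.outputsFun x
  have H := StepsIn.length_le (M := h.tm.m)
    (fun l => Finset.single_le_sum (f := fun l => pushes (h.tm.m l)) (fun _ _ => Nat.zero_le _)
      (Finset.mem_univ l)) (c := initList h.tm _) (c' := haltList h.tm _) hx.evals_in_steps h.tm.k₁
  rw [initList_stk, haltList_stk] at H
  have h₁ : ∀ l : List (h.tm.Γ h.tm.k₀),
      (update (fun _ => []) h.tm.k₀ l h.tm.k₁ : List (h.tm.Γ h.tm.k₁)).length ≤ l.length := by
    intro l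
    generalize h.tm.k₁ = k
    by_cases hk : k = h.tm.k₀
    · subst hk; simp
    · simp [hk]
  have h₂ := (H.trans (Nat.add_le_add_right (h₁ _) _)).trans
    (Nat.add_le_add_left (Nat.mul_le_mul_right _ hx.steps_le_m) _)
  simpa using h₂

namespace Prog

variable {tm : FinTM2}

/-! ### Reading the input and running the machine -/

theorem Within.congr {p : Prog tm} {S S' U U' : Stacks tm} {t t' : ℕ} (h : p.Within S S' t)
    (h₁ : S = U) (h₂ : S' = U') (ht : t ≤ t') : p.Within U U' t' := by
  subst h₁ h₂; exact h.mono ht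

theorem within_put (S : ∀ k, List (tm.Γ k)) (T : Reg → List Symbol) (r : Reg) (s : Symbol) :
    (put r s : Prog tm).Within (join S T) (join S (update T r (s :: T r))) 1 := by
  rw [← update_join_inr]
  exact within_push (S := join S T) (Sum.inr r) s

theorem within_push_inl (S : ∀ k, List (tm.Γ k)) (T : Reg → List Symbol) (k : tm.K)
    (a : tm.Γ k) :
    (push (Sum.inl k) a : Prog tm).Within (join S T) (join (update S k (a :: S k)) T) 1 := by
  rw [← update_join_inl]
  exact within_push (S := join S T) (Sum.inl k) a

theorem within_forPop_inl_cons {S : ∀ k, List (tm.Γ k)} {T : Reg → List Symbol}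
    {S' S'' : Stacks tm} {t t' : ℕ} {k : tm.K} {rd : tm.Γ k → Symbol} {body : Symbol → Prog tm}
    {a : tm.Γ k} {l : List (tm.Γ k)}
    (h₁ : (body (rd a)).Within (join (update S k l) T) S' t)
    (h₂ : (forPop (Sum.inl k) rd body).Within S' S'' t') :
    (forPop (Sum.inl k) rd body).Within (join (update S k (a :: l)) T) S'' (t + t' + 1) := by
  refine within_forPop_cons (k := Sum.inl k) (a := a) (l := l) ?_ ?_ h₂
  · exact update_self k (a :: l) S
  · rw [update_join_inl, update_idem]
    exact h₁

theorem within_forPop_inl_nil {S : ∀ k, List (tm.Γ k)} {T : Reg → List Symbol} {k : tm.K}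
    {rd : tm.Γ k → Symbol} {body : Symbol → Prog tm} :
    (forPop (Sum.inl k) rd body).Within (join (update S k []) T) (join (update S k []) T) 1 :=
  within_forPop_nil (k := Sum.inl k) (show update S k [] k = [] from update_self k [] S)

theorem within_read (k : tm.K) (rd : tm.Γ k → Symbol) (l : List (tm.Γ k))
    (T : Reg → List Symbol) :
    (forPop (Sum.inl k) rd (fun s => seq (put .inp s) (put .n .tick)) : Prog tm).Within
      (join (update (fun _ => []) k l) T)
      (join (update (fun _ => []) k []) (update (update T .inp ((l.map rd).reverse ++ T .inp)) .n
        (ticks l.length ++ T .n))) (3 * l.length + 1) := by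
  induction l generalizing T with
  | nil => exact within_forPop_inl_nil.congr rfl (by simp) le_rfl
  | cons a l ih =>
    refine (within_forPop_inl_cons ((within_put _ _ _ _).seq (within_put _ _ _ _))
      (ih _)).congr rfl ?_ (by simp; omega)
    congr 1
    funext x
    by_cases h₁ : x = .n <;> by_cases h₂ : x = .inp <;> simp_all [List.replicate_succ']

theorem within_write (k : tm.K) (wr : Symbol → tm.Γ k) (l : List Symbol) (a : List (tm.Γ k))
    (T : Reg → List Symbol) (hT : T .inp = l) :
    (loop .inp (fun s => push (Sum.inl k) (wr s)) : Prog tm).Within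
      (join (update (fun _ => []) k a) T)
      (join (update (fun _ => []) k ((l.map wr).reverse ++ a)) (update T .inp []))
      (2 * l.length + 1) := by
  induction l generalizing T a with
  | nil =>
    have e : update T .inp [] = T := by rw [← hT, update_eq_self]
    exact (within_forPop_nil (k := Sum.inr .inp) hT).congr rfl (by simp [e]) le_rfl
  | cons s l ih =>
    refine (within_forPop_cons (k := Sum.inr .inp) (a := s) (l := l) hT ?_
      (ih (wr s :: a) (update T .inp l) (by simp))).congr rfl (by simp) ?_ (t := 1 + _ + 1)
    · rw [update_join_inr]
      exact (within_push_inl _ _ k (wr s)).congr rfl (by simp) le_rfl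
    · simp; omega

theorem within_collect (k : tm.K) (rd : tm.Γ k → Symbol) (l : List (tm.Γ k))
    (T : Reg → List Symbol) :
    (forPop (Sum.inl k) rd (fun s => put .rev s) : Prog tm).Within
      (join (update (fun _ => []) k l) T)
      (join (update (fun _ => []) k []) (update T .rev ((l.map rd).reverse ++ T .rev)))
      (2 * l.length + 1) := by
  induction l generalizing T with
  | nil => exact within_forPop_inl_nil.congr rfl (by simp) le_rfl
  | cons a l ih =>
    exact (within_forPop_inl_cons (within_put _ _ _ _) (ih _)).congr rfl (by simp)
      (by simp; omega)

/-- The stacks on which the input has been evaluated. -/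
def initRegs (n w m : ℕ) (r : List Symbol) : Reg → List Symbol
  | .n => ticks n
  | .w => ticks w
  | .m => ticks m
  | .rev => r
  | _ => []

end Prog

open Prog

/-- The machine that runs the program `p`. -/
noncomputable def Prog.machine {tm : FinTM2} (p : Prog tm) : FinTM2 where
  K := tm.K ⊕ Reg
  kFin := have := tm.kFin; inferInstance
  k₀ := Sum.inl tm.k₀
  k₁ := Sum.inr .out
  Γ := Alph tm
  Λ := Option p.Lab
  main := some p.entry
  ΛFin := have := p.finite_lab; Fintype.ofFinite _
  σ := tm.σ × Option Symbol
  initialState := (tm.initialState, none)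
  σFin := have := tm.σFin; inferInstance
  Γk₀Fin := tm.Γk₀Fin
  m
    | none => .load (fun _ => (tm.initialState, none)) .halt
    | some l => p.code some none l

theorem Prog.Within.outputs {tm : FinTM2} {p : Prog tm} {l : List (tm.Γ tm.k₀)}
    {l' : List Symbol} {t : ℕ}
    (h : p.Within (join (update (fun _ => []) tm.k₀ l) fun _ => [])
      (join (fun _ => []) (update (fun _ => []) .out l')) t) :
    Nonempty (TM2OutputsInTime p.machine l (some l') (t + 1)) := by
  obtain ⟨b, n, hn, H⟩ := h (Option p.Lab) p.machine.m some none (fun _ => rfl) none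
  -- The exit label `none` costs one more step: it clears the symbol buffer, because `haltList`
  -- requires the exact initial state.
  have H' := H.trans (n := 1) (c := haltList p.machine l') (StepsIn.one (by
    have e : (haltList p.machine l').stk = join (fun _ => []) (update (fun _ => []) .out l') := by
      refine (haltList_stk p.machine l').trans ?_
      rw [← update_join_inr]
      congr 1
      funext k
      cases k <;> rfl
    rw [← e]; rfl))
  have e : initList p.machine l = ⟨some (some p.entry), (tm.initialState, none),
      join (update (fun _ => []) tm.k₀ l) fun _ => []⟩ := by
    have : (initList p.machine l).stk = join (update (fun _ => []) tm.k₀ l) fun _ => [] := by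
      refine (initList_stk p.machine l).trans ?_
      rw [← update_join_inl]
      congr 1
      funext k
      cases k <;> rfl
    rw [← this]; rfl
  exact ⟨⟨⟨n + 1, by rw [e]; exact H'⟩, Nat.succ_le_succ hn⟩⟩

theorem polyBdd_hornerTime (cs : List ℕ) : PolyBdd (hornerTime cs) := by
  have hv : ∀ cs, PolyBdd (hornerVal cs) := by
    intro cs
    induction cs with
    | nil => exact .const 0
    | cons c cs ih => exact .add (.const _) (.mul ih .id)
  induction cs with
  | nil => exact .const 1
  | cons c cs ih =>
    exact .add ih (.add (.add (.mul (hv _) (.add (.mul (.const _) .id) (.const _))) (.const _))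
      (.const _))

/-- If a program computes `g x` from the description `f x`, the length of `x` and the values of two
polynomials at it, then `g` is computable in polynomial time if `f` is. -/
theorem nonempty_computable_of_prog {f g : List Bool → List Symbol} (w m : Polynomial ℕ)
    (h : TM2ComputableInPolyTime (id : List Bool → List Bool) (id : List Symbol → List Symbol) f)
    (p : Prog h.tm) {t : ℕ → ℕ} (ht : PolyBdd t)
    (hp : ∀ x : List Bool,
      p.Aux (initRegs x.length (w.eval x.length) (m.eval x.length) (f x).reverse)
        (update (initRegs x.length (w.eval x.length) (m.eval x.length) (f x).reverse) .out (g x))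
        (t x.length)) :
    Nonempty (TM2ComputableInPolyTime (id : List Bool → List Bool)
      (id : List Symbol → List Symbol) g) := by
  obtain ⟨cw, hw⟩ := exists_hornerVal w
  obtain ⟨cm, hm⟩ := exists_hornerVal m
  -- The working stacks hold only `Symbol`s, so the input bits pass through them encoded as `tick`
  -- and `sep`.
  obtain ⟨L, hL, hfL⟩ := polyBdd_length h
  let enc : Bool → Symbol := fun b => if b then .tick else .sep
  let dec : Symbol → Bool := fun s => s = .tick
  have hdec : ∀ b, dec (enc b) = b := by decide
  -- Counting the input consumes it, so it is kept on `inp` and pushed back before the call; the two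
  -- transfers cancel their reversals. At the end every stack except `out` must be empty.
  let P : Prog h.tm :=
    seq (forPop (Sum.inl h.tm.k₀) (fun a => enc (h.inputAlphabet a))
      fun s => seq (put .inp s) (put .n .tick)) <|
    seq (loop .inp fun s => push (Sum.inl h.tm.k₀) (h.inputAlphabet.symm (dec s))) <|
    seq call <|
    seq (forPop (Sum.inl h.tm.k₁) h.outputAlphabet (put .rev)) <|
    seq (horner .w cw) <| seq (horner .m cm) <| seq p <|
    seq (loop .n fun _ => skip) <| seq (loop .w fun _ => skip) <|
    seq (loop .m fun _ => skip) (loop .rev fun _ => skip)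
  -- One summand for each piece of `P`; the final 1 is the halting step.
  let time : ℕ → ℕ := fun n => (3 * n + 1) + ((2 * n + 1) + (h.time.eval n + ((2 * L n + 1) +
    (hornerTime cw n + (hornerTime cm n + (t n + ((2 * n + 1) + ((2 * w.eval n + 1) +
      ((2 * m.eval n + 1) + (2 * L n + 1)))))))))) + 1
  have htime : PolyBdd time := by
    have hlin : ∀ {f : ℕ → ℕ}, PolyBdd f → PolyBdd fun n => 2 * f n + 1 :=
      fun hf => .add (.mul (.const 2) hf) (.const 1)
    exact .add (.add (.add (.mul (.const 3) .id) (.const 1)) <| .add (hlin .id) <|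
      .add (.eval _) <| .add (hlin hL) <| .add (polyBdd_hornerTime cw) <|
      .add (polyBdd_hornerTime cm) <| .add ht <| .add (hlin .id) <| .add (hlin (.eval w)) <|
      .add (hlin (.eval m)) (hlin hL)) (.const 1)
  obtain ⟨q, hq⟩ := htime
  have main : ∀ x : List Bool, P.Within
      (join (update (fun _ => []) h.tm.k₀ (x.map h.inputAlphabet.symm)) fun _ => [])
      (join (fun _ => []) (update (fun _ => []) .out (g x))) (time x.length - 1) := by
    intro x
    have hnil : ∀ {k}, update (fun k : h.tm.K => ([] : List (h.tm.Γ k))) k [] = fun _ => [] := by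
      simp
    have s₁ := within_read h.tm.k₀ (fun a => enc (h.inputAlphabet a))
      (x.map h.inputAlphabet.symm) (fun _ => [])
    have s₂ := within_write h.tm.k₀ (fun s => h.inputAlphabet.symm (dec s)) (x.map enc).reverse []
      (update (update (fun _ => []) .inp (x.map enc).reverse) .n (ticks x.length)) (by simp)
    have s₃ := within_call (T := update (fun _ => []) .n (ticks x.length)) (h.outputsFun x)
    rw [initList_stk, haltList_stk] at s₃
    have s₄ := within_collect h.tm.k₁ h.outputAlphabet ((f x).map h.outputAlphabet.symm)
      (update (fun _ => []) .n (ticks x.length))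
    have s₅ := aux_horner (tm := h.tm) (d := .w) (by simp) (by simp) (by simp) cw (n := x.length)
      (T := update (update (fun _ => []) .n (ticks x.length)) .rev (f x).reverse)
      (by simp) (by simp) (by simp) (by simp)
    have s₆ := aux_horner (tm := h.tm) (d := .m) (by simp) (by simp) (by simp) cm (n := x.length)
      (T := update (update (update (fun _ => []) .n (ticks x.length)) .rev (f x).reverse) .w
        (ticks (w.eval x.length)))
      (by simp) (by simp) (by simp) (by simp)
    have s₇ := hp x
    have s₈ := ((aux_clear .n).seq ((aux_clear .w).seq ((aux_clear .m).seq
      (aux_clear (tm := h.tm) (T := update (update (update (update (initRegs x.length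
        (w.eval x.length) (m.eval x.length) (f x).reverse) .out (g x)) .n []) .w []) .m []) .rev))))
    refine Within.congr (s₁.seq <| Within.seq (s₂.congr ?_ rfl le_rfl) <|
      Within.seq (s₃.congr ?_ rfl le_rfl) <| Within.seq (s₄.congr ?_ rfl le_rfl) <|
      Within.seq (Within.congr s₅ ?_ rfl le_rfl) <| Within.seq (Within.congr s₆ ?_ rfl le_rfl) <|
      Within.seq (Within.congr s₇ ?_ rfl le_rfl) s₈) rfl ?_ ?_
    · simp [Function.comp_def]
    · simp only [List.map_reverse, List.map_map, Function.comp_def, hdec, List.reverse_reverse,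
        List.append_nil, id]
      congr 1
      funext r
      cases r <;> simp
    · simp
    · simp only [List.map_map, Function.comp_def, Equiv.apply_symm_apply, List.map_id', hnil]
      congr 1
      funext r
      cases r <;> simp
    · congr 1
      funext r
      cases r <;> simp [hw]
    · congr 1
      funext r
      cases r <;> simp [hm, initRegs]
    · congr 1
      funext r
      cases r <;> simp [initRegs]
    · have := hfL x
      simp only [time, initRegs, List.length_map, List.length_reverse, id, ne_eq, reduceCtorEq,
        not_false_eq_true, update_of_ne, List.length_replicate]
      omega
  refine ⟨⟨⟨P.machine, h.inputAlphabet, Equiv.refl Symbol⟩, q, fun x => ?_⟩⟩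
  have H := (main x).outputs.some
  refine ⟨⟨H.steps, ?_⟩, H.steps_le_m.trans ((Nat.le_of_eq ?_).trans (hq _))⟩
  · have := H.evals_in_steps
    have e : List.map (Equiv.refl Symbol).invFun (_root_.id (g x)) = g x := List.map_id _
    exact this.trans (congrArg (fun l => Option.map (haltList P.machine) (some l)) e.symm)
  · simp [time]

end SBQPMerlin

/-! ### Inverse circuits and programs that write descriptions. -/

namespace SBQPMerlin

open Turing Function

/-! ### Inverse circuits -/

/-- The inverse of a gate. -/
def Gate.inv {N : ℕ} : Gate N → Gate N
  | .tGate t => .tInv t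
  | .tInv t => .tGate t
  | g => g

/-- The inverse of a circuit. -/
def Circuit.inv {N : ℕ} : Circuit N → Circuit N
  | [] => []
  | g :: C => Circuit.inv C ++ [g.inv]

theorem Circuit.encode_cons {N : ℕ} (g : Gate N) (C : Circuit N) :
    Circuit.encode (g :: C) = g.encode ++ Circuit.encode C := rfl

theorem Circuit.encode_append {N : ℕ} (C D : Circuit N) :
    Circuit.encode (C ++ D) = Circuit.encode C ++ Circuit.encode D := List.flatMap_append

namespace Symbol

/-- Whether a symbol is the name of a gate. -/
def isName : Symbol → Bool
  | tick => false
  | sep => false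
  | _ => true

/-- The name of the inverse of a gate. -/
def inv : Symbol → Symbol
  | tGate => tInv
  | tInv => tGate
  | s => s

end Symbol

/-- Gate boundaries are visible in a description: a name occurs only at the start of a gate, and it
is the only symbol that inversion changes. -/
theorem Gate.exists_encode {N : ℕ} (g : Gate N) : ∃ s l, s.isName = true ∧
    (∀ a ∈ l, a.isName = false ∧ a.inv = a) ∧ g.encode = s :: l ∧ g.inv.encode = s.inv :: l := by
  have hn : ∀ {q : Fin N}, ∀ a ∈ encodeQubit q, a.isName = false ∧ a.inv = a := by
    intro q a ha
    simp only [encodeQubit, List.mem_append, List.mem_replicate, List.mem_singleton] at ha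
    rcases ha with ⟨_, rfl⟩ | rfl <;> exact ⟨rfl, rfl⟩
  have ha : ∀ {l₁ l₂ : List Symbol}, (∀ a ∈ l₁, a.isName = false ∧ a.inv = a) →
      (∀ a ∈ l₂, a.isName = false ∧ a.inv = a) → ∀ a ∈ l₁ ++ l₂, a.isName = false ∧ a.inv = a := by
    intro l₁ l₂ h₁ h₂ a ha
    rcases List.mem_append.1 ha with h | h
    exacts [h₁ a h, h₂ a h]
  cases g with
  | toffoli => exact ⟨_, _, rfl, ha (ha hn hn) hn, rfl, rfl⟩
  | cnot => exact ⟨_, _, rfl, ha hn hn, rfl, rfl⟩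
  | _ => exact ⟨_, _, rfl, hn, rfl, rfl⟩

/-- One step of inverting the description of a circuit: `p.1` holds the reversed description of the
inverse of the current gate, and `p.2` the description of the inverse of the gates before it. -/
def invStep (p : List Symbol × List Symbol) (s : Symbol) : List Symbol × List Symbol :=
  if s.isName then ([s.inv], p.1.reverse ++ p.2) else (s.inv :: p.1, p.2)

/-- Inversion reverses the order of the gates but not of the symbols inside a gate. Each name
therefore closes the previous block, which goes, unreversed, in front of what has been collected. -/
theorem foldl_invStep_encode {N : ℕ} (C : Circuit N) (p : List Symbol × List Symbol) :
    ((Circuit.encode C).foldl invStep p).1.reverse ++ ((Circuit.encode C).foldl invStep p).2 =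
      Circuit.encode C.inv ++ (p.1.reverse ++ p.2) := by
  induction C generalizing p with
  | nil => rfl
  | cons g C ih =>
    obtain ⟨s, l, hs, hl, hg, hg'⟩ := g.exists_encode
    have hfold : ∀ (l : List Symbol), (∀ a ∈ l, a.isName = false ∧ a.inv = a) →
        ∀ p, l.foldl invStep p = (l.reverse ++ p.1, p.2) := by
      intro l
      induction l with
      | nil => simp
      | cons a l ihl =>
        intro hl p
        have ha := hl a (by simp)
        rw [List.foldl_cons, ihl (fun b hb => hl b (by simp [hb]))]
        simp [invStep, ha.1, ha.2]
    rw [Circuit.encode_cons, List.foldl_append, ih, hg, List.foldl_cons, hfold l hl,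
      Circuit.inv, Circuit.encode_append, Circuit.encode_cons, hg']
    simp [invStep, hs, Circuit.encode]

theorem length_foldl_invStep (l : List Symbol) (p : List Symbol × List Symbol) :
    (l.foldl invStep p).1.length ≤ p.1.length + l.length + 1 := by
  induction l generalizing p with
  | nil => simp
  | cons s l ih =>
    refine (ih _).trans ?_
    by_cases h : s.isName <;> simp [invStep, h] <;> omega

/-! ### Descriptions of gates -/

/-- The description of `X` on the qubit with number `q`. -/
def strX (q : ℕ) : List Symbol := .pauliX :: num q

/-- The description of the Hadamard gate on the qubit with number `q`. -/
def strH (q : ℕ) : List Symbol := .hadamard :: num q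

/-- The description of a controlled NOT. -/
def strCnot (a b : ℕ) : List Symbol := .cnot :: (num a ++ num b)

/-- The description of a Toffoli gate. -/
def strToffoli (a b c : ℕ) : List Symbol := .toffoli :: (num a ++ (num b ++ num c))

/-- For `p < w`, a controlled NOT from the qubit `p` to the qubit `N + p`, after a Hadamard gate on
the qubit `p` if `had` is true. -/
def strPairs (had : Bool) (N : ℕ) : ℕ → List Symbol
  | 0 => []
  | p + 1 => (if had then strH p else []) ++ (strCnot p (N + p) ++ strPairs had N p)

/-- For `i < j`, set the flag `c + i` if the flag `c + i + 1` is set and the qubit `w + i` is `0`. -/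
def strChecks (w c : ℕ) : ℕ → List Symbol
  | 0 => []
  | j + 1 => strX (w + j) ++ (strToffoli (w + j) (c + j + 1) (c + j) ++
      (strX (w + j) ++ strChecks w c j))

/-- One round: the circuit `U`, a check of the qubit `0`, the inverse circuit, a check of the
ancillas. -/
def strRound (w m c : ℕ) (U U' : List Symbol) : List Symbol :=
  U ++ (strToffoli 0 (c + m + 1) (c + m) ++ (U' ++ strChecks w c m))

/-- The last `i` rounds. -/
def strRounds (w m c : ℕ) (U U' : List Symbol) : ℕ → List Symbol
  | 0 => []
  | i + 1 => strRound w m (c + i * (m + 1)) U U' ++ strRounds w m c U U' i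

/-- The description of the circuit that decides with maximally mixed witness. -/
def strAmplify (w m : ℕ) (U U' : List Symbol) : List Symbol :=
  strPairs true (w + m) w ++ (strX (w + m + w + (w + 1) * (m + 1)) ++
    (strRounds w m (w + m + w) U U' (w + 1) ++
      (strCnot 0 (w + m + w) ++ strCnot (w + m + w) 0)))

namespace Prog

variable {tm : FinTM2} {p q : Prog tm} {T T' : Reg → List Symbol} {s s' : List Symbol} {t t' : ℕ}

/-! ### Programs that write -/

/-- Started with the working stacks `T` up to the output, `p` puts the string `s` in front of the
output and changes nothing else. -/
def Emits (p : Prog tm) (T : Reg → List Symbol) (s : List Symbol) (t : ℕ) : Prop :=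
  ∀ o, p.Aux (update T .out o) (update T .out (s ++ o)) t

theorem Emits.aux (h : p.Emits T s t) : p.Aux T (update T .out (s ++ T .out)) t :=
  (h (T .out)).congr (update_eq_self _ _) rfl le_rfl

/-- The output is a stack, so what is written later stands further in front. All descriptions are
produced from the last gate to the first. -/
theorem Emits.seq (hp : p.Emits T s t) (hq : q.Emits T s' t') :
    (seq p q).Emits T (s' ++ s) (t + t') :=
  fun o => ((hp o).seq (hq _)).congr rfl (by simp) le_rfl

theorem emits_put (a : Symbol) : (put .out a : Prog tm).Emits T [a] 1 :=
  fun o => (aux_put _ _).congr rfl (by simp) le_rfl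

theorem emits_skip : (skip : Prog tm).Emits T [] 1 :=
  fun _ => aux_skip

/-- Write the number on the stack `r`. -/
def emitNum (r : Reg) : Prog tm := seq (put .out .sep) (rep r .e (put .out .tick))

theorem emits_num {r : Reg} (h₁ : r ≠ .out) (h₂ : r ≠ .e) {n B : ℕ} (hr : T r = ticks n)
    (he : T .e = []) (hB : n ≤ B) : (emitNum r : Prog tm).Emits T (num n) (5 * B + 3) := by
  intro o
  refine ((aux_put _ _).seq (aux_rep_put (n := n) h₂ h₁.symm (by simp) ?_ ?_)).congr rfl ?_
    (by omega)
  · simp [h₁, hr]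
  · simp [he]
  · simp

/-- Write the successor of the number on the stack `r`. -/
def emitSucc (r : Reg) : Prog tm := seq (emitNum r) (put .out .tick)

theorem emits_succ {r : Reg} (h₁ : r ≠ .out) (h₂ : r ≠ .e) {n B : ℕ} (hr : T r = ticks n)
    (he : T .e = []) (hB : n ≤ B) : (emitSucc r : Prog tm).Emits T (num (n + 1)) (5 * B + 4) :=
  (emits_num h₁ h₂ hr he hB).seq (emits_put _)

/-- Write the circuit whose reversed description is on the stack `rev`. -/
def emitForward : Prog tm :=
  seq (loop .rev fun s => seq (put .out s) (put .dir s)) (loop .dir (put .rev))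

theorem emits_forward {D : List Symbol} (hr : T .rev = D.reverse) (hd : T .dir = []) {B : ℕ}
    (hB : D.length ≤ B) : (emitForward : Prog tm).Emits T D (5 * B + 2) := by
  intro o
  have h := aux_loop (tm := tm) (r := .rev) (t := 2) (body := fun s => seq (put .out s) (put .dir s))
    D.reverse (fun i => update (update (update T .rev (D.reverse.drop i)) .dir
      (D.reverse.take i).reverse) .out ((D.reverse.take i).reverse ++ o)) (by simp)
    (by
      intro i hi
      refine ((aux_put _ _).seq (aux_put _ _)).congr rfl ?_ le_rfl
      rw [← List.take_concat_get' _ _ hi]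
      funext r
      cases r <;> simp)
  refine (h.seq (aux_move (by simp))).congr ?_ ?_ ?_
  · funext r
    cases r <;> simp [hr, hd]
  · rw [List.take_length]
    funext r
    cases r <;> simp [hr, hd]
  · simp; omega

/-- Write the inverse of the circuit whose reversed description is on the stack `rev`. -/
def emitInverse : Prog tm :=
  seq (loop .rev (put .dir)) <|
  seq (loop .dir fun s => seq (if s.isName then loop .blk (put .out) else skip)
    (seq (put .blk s.inv) (put .rev s)))
  (loop .blk (put .out))

/-- The stacks `blk` and `out` realize the two components of the fold of `invStep`. The time bound
is quadratic since every symbol is charged with emptying a block of at most `B + 1` symbols. -/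
theorem emits_inverse {N : ℕ} {C : Circuit N} (hr : T .rev = (Circuit.encode C).reverse)
    (hd : T .dir = []) (hb : T .blk = []) {B : ℕ} (hB : (Circuit.encode C).length ≤ B) :
    (emitInverse : Prog tm).Emits T (Circuit.encode C.inv) (B * (2 * B + 6) + 4 * B + 6) := by
  intro o
  set D := Circuit.encode C
  have hlen : ∀ i, ((D.take i).foldl invStep ([], o)).1.length ≤ B + 1 := by
    intro i
    have h₁ := length_foldl_invStep (D.take i) ([], o)
    have h₂ := List.length_take_le' i D
    simp only [List.length_nil] at h₁
    omega
  have h := aux_loop (tm := tm) (r := .dir) (t := 2 * B + 5)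
    (body := fun s => seq (if s.isName then loop .blk (put .out) else skip)
      (seq (put .blk s.inv) (put .rev s)))
    D (fun i => update (update (update (update T .rev (D.take i).reverse) .dir (D.drop i)) .blk
      ((D.take i).foldl invStep ([], o)).1) .out ((D.take i).foldl invStep ([], o)).2) (by simp)
    (by
      intro i hi
      have hi' := hlen i
      rw [← List.take_concat_get' _ _ hi, List.foldl_append]
      generalize (D.take i).foldl invStep ([], o) = p at *
      generalize D[i] = s
      cases hs : s.isName
      · refine (aux_skip.seq ((aux_put _ _).seq (aux_put _ _))).congr rfl ?_ (by omega)
        funext r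
        cases r <;> simp [invStep, hs]
      · refine ((aux_move (by simp)).seq ((aux_put _ _).seq (aux_put _ _))).congr rfl ?_ ?_
        · funext r
          cases r <;> simp [invStep, hs]
        · simp; omega)
  refine ((aux_move (by simp)).seq ((h.congr ?_ rfl le_rfl).seq (aux_move (by simp)))).congr
    rfl ?_ ?_
  · funext r
    cases r <;> simp [hr, hd, hb]
  · rw [List.take_length]
    have := foldl_invStep_encode C ([], o)
    simp only [List.reverse_nil, List.nil_append] at this
    rw [← this]
    funext r
    cases r <;> simp [hr, hd, hb, D]
  · have h₁ := hlen D.length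
    have h₂ : D.length * (2 * B + 5 + 1) ≤ B * (2 * B + 6) := Nat.mul_le_mul_right _ hB
    simp [hr] at h₁ ⊢
    omega

/-- Write `X` on the qubit whose number is on the stack `r`. -/
def emitX (r : Reg) : Prog tm := seq (emitNum r) (put .out .pauliX)

theorem emits_x {r : Reg} (h₁ : r ≠ .out) (h₂ : r ≠ .e) {n B : ℕ} (hr : T r = ticks n)
    (he : T .e = []) (hB : n ≤ B) : (emitX r : Prog tm).Emits T (strX n) (5 * B + 4) :=
  (emits_num h₁ h₂ hr he hB).seq (emits_put _)

/-- Write a check of the qubit whose number is on the stack `q`. -/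
def emitCheck : Prog tm :=
  seq (emitX .q) (seq (seq (emitNum .c) (seq (emitSucc .c) (seq (emitNum .q) (put .out .toffoli))))
    (emitX .q))

theorem emits_check {n c B : ℕ} (hq : T .q = ticks n) (hc : T .c = ticks c) (he : T .e = [])
    (hn : n ≤ B) (hB : c ≤ B) : (emitCheck : Prog tm).Emits T
      (strX n ++ (strToffoli n (c + 1) c ++ strX n)) (25 * B + 20) := by
  have hx := emits_x (tm := tm) (by simp) (by simp) hq he hn
  have hc₁ := emits_num (tm := tm) (by simp) (by simp) hc he hB
  have hc₂ := emits_succ (tm := tm) (by simp) (by simp) hc he hB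
  have hq₁ := emits_num (tm := tm) (by simp) (by simp) hq he hn
  intro o
  refine ((hx.seq ((hc₁.seq (hc₂.seq (hq₁.seq (emits_put _)))).seq hx)) o).congr rfl ?_ (by omega)
  simp [strToffoli]

/-- Write the checks of the ancillas. -/
def emitChecks : Prog tm :=
  rep .m .ml (seq emitCheck (seq (put .q .tick) (put .c .tick)))

theorem aux_checks {w m c B : ℕ} (hm : T .m = ticks m) (hl : T .ml = []) (hq : T .q = ticks w)
    (hc : T .c = ticks c) (he : T .e = []) (hB : w + m ≤ B) (hB' : c + m ≤ B) :
    (emitChecks : Prog tm).Aux T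
      (update (update (update T .q (ticks (w + m))) .c (ticks (c + m))) .out
        (strChecks w c m ++ T .out)) (B * (25 * B + 26) + 2) := by
  have h := aux_rep (tm := tm) (r := .m) (r' := .ml) (n := m) (t := 25 * B + 22)
    (body := seq emitCheck (seq (put .q .tick) (put .c .tick))) (by simp)
    (fun i => update (update (update T .q (ticks (w + i))) .c (ticks (c + i))) .out
        (strChecks w c i ++ T .out)) (by simp [hm]) (by simp [hl]) (by simp [hm]) (by simp [hl])
    (by
      intro i hi a b
      refine ((emits_check (n := w + i) (c := c + i) (B := B) (by simp) (by simp) (by simp [he])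
        (by omega) (by omega)).aux.seq ((aux_put _ _).seq (aux_put _ _))).congr rfl ?_ (by omega)
      funext r
      cases r <;> simp [strChecks, ← ticks_succ, add_assoc])
  refine h.congr ?_ rfl ?_
  · funext r
    cases r <;> simp [hq, hc, strChecks]
  · have : m * (25 * B + 22 + 4) ≤ B * (25 * B + 26) := Nat.mul_le_mul_right _ (by omega)
    omega

/-- Write one round. -/
def emitRound : Prog tm :=
  seq (rep .w .wl (put .q .tick)) <| seq emitChecks <| seq (loop .q fun _ => skip) <|
  seq emitInverse <|
  seq (seq (emitNum .c) (seq (emitSucc .c) (seq (put .out .sep) (put .out .toffoli)))) <|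
  seq (put .c .tick) emitForward

/-- A bound on the running time of `emitRound`. -/
def roundTime (B : ℕ) : ℕ := 27 * (B * B) + 70 * B + 40

theorem aux_round {N : ℕ} {C : Circuit N} {w m c B : ℕ} (hw : T .w = ticks w) (hwl : T .wl = [])
    (hm : T .m = ticks m) (hl : T .ml = []) (hq : T .q = []) (hc : T .c = ticks c)
    (he : T .e = []) (hr : T .rev = (Circuit.encode C).reverse) (hd : T .dir = [])
    (hb : T .blk = []) (hB₁ : w + m ≤ B) (hB₂ : c + m ≤ B) (hB₃ : (Circuit.encode C).length ≤ B) :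
    (emitRound : Prog tm).Aux T (update (update T .c (ticks (c + (m + 1)))) .out
      (strRound w m c (Circuit.encode C) (Circuit.encode C.inv) ++ T .out)) (roundTime B) := by
  -- The contents between the pieces of the program, which writes the round backwards: ancilla
  -- checks, inverse circuit, output check, circuit.
  let T₁ := update T .q (ticks w)
  let T₂ := update (update (update T .q (ticks (w + m))) .c (ticks (c + m))) .out
    (strChecks w c m ++ T .out)
  let T₃ := update (update T .c (ticks (c + m))) .out (strChecks w c m ++ T .out)
  let T₄ := update (update T .c (ticks (c + m))) .out
    (strToffoli 0 (c + m + 1) (c + m) ++ (Circuit.encode C.inv ++ (strChecks w c m ++ T .out)))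
  let T₅ := update (update T .c (ticks (c + (m + 1)))) .out
    (strToffoli 0 (c + m + 1) (c + m) ++ (Circuit.encode C.inv ++ (strChecks w c m ++ T .out)))
  have h₁ : (rep .w .wl (put .q .tick) : Prog tm).Aux T T₁ (w * 5 + 2) :=
    (aux_rep_put (by simp) (by simp) (by simp) hw hwl).congr rfl (by simp [hq, T₁]) le_rfl
  have h₂ := aux_checks (tm := tm) (T := T₁) (w := w) (m := m) (c := c) (B := B) (by simp [T₁, hm])
    (by simp [T₁, hl]) (by simp [T₁]) (by simp [T₁, hc]) (by simp [T₁, he]) hB₁ hB₂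
  have h₃ := aux_clear (tm := tm) (T := T₂) .q
  have h₄ := (emits_inverse (tm := tm) (T := T₃) (C := C) (B := B) (by simp [T₃, hr])
    (by simp [T₃, hd]) (by simp [T₃, hb]) hB₃)
  have h₅ := ((emits_num (tm := tm) (T := T₃) (r := .c) (n := c + m) (by simp) (by simp)
    (by simp [T₃]) (by simp [T₃, he]) hB₂).seq ((emits_succ (tm := tm) (T := T₃) (r := .c)
    (n := c + m) (by simp) (by simp) (by simp [T₃]) (by simp [T₃, he]) hB₂).seq
      -- A lone end mark is the unary number 0, the output qubit.
      ((emits_put .sep).seq (emits_put .toffoli))))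
  have h₆ := aux_put (tm := tm) (T := T₄) .c .tick
  have h₇ := (emits_forward (tm := tm) (T := T₅) (B := B) (by simp [T₅, hr]) (by simp [T₅, hd])
    hB₃).aux
  refine (h₁.seq ((h₂.congr rfl (U' := T₂) ?_ le_rfl).seq ((h₃.congr rfl (U' := T₃) ?_ le_rfl).seq
    (h₄.aux.seq (((h₅ _).congr rfl (U' := T₄) ?_ le_rfl).seq ((h₆.congr rfl (U' := T₅) ?_ le_rfl).seq
      h₇)))))).congr rfl ?_ ?_
  · funext r
    cases r <;> simp [T₁, T₂]
  · funext r
    cases r <;> simp [T₂, T₃, hq]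
  · funext r
    cases r <;> simp [T₃, T₄, strToffoli]
  · funext r
    cases r <;> simp [T₄, T₅, ← ticks_succ, add_assoc]
  · funext r
    cases r <;> simp [T₅, strRound]
  · simp only [T₂, roundTime, ne_eq, reduceCtorEq, not_false_eq_true, update_of_ne, update_self,
      List.length_replicate]
    ring_nf
    have : B * B = B ^ 2 := by ring
    omega

end Prog

end SBQPMerlin

/-! ### Programs for the two circuit transformations, and uniformity. -/

namespace SBQPMerlin

open Turing Function

namespace Prog

variable {tm : FinTM2} {T : Reg → List Symbol}

theorem aux_rounds {N : ℕ} {C : Circuit N} {w m c k B : ℕ} (hw : T .w = ticks w)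
    (hwl : T .wl = []) (hm : T .m = ticks m) (hl : T .ml = []) (hk : T .k = ticks k)
    (hkl : T .kl = []) (hq : T .q = []) (hc : T .c = ticks c)
    (he : T .e = []) (hr : T .rev = (Circuit.encode C).reverse) (hd : T .dir = [])
    (hb : T .blk = []) (hB₁ : w + m ≤ B) (hB₂ : c + k * (m + 1) ≤ B)
    (hB₃ : (Circuit.encode C).length ≤ B) :
    (rep .k .kl emitRound : Prog tm).Aux T (update (update T .c (ticks (c + k * (m + 1)))) .out
      (strRounds w m c (Circuit.encode C) (Circuit.encode C.inv) k ++ T .out))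
      (k * (roundTime B + 4) + 2) := by
  have h := aux_rep (tm := tm) (r := .k) (r' := .kl) (n := k) (t := roundTime B)
    (body := emitRound) (by simp)
    (fun i => update (update T .c (ticks (c + i * (m + 1)))) .out
      (strRounds w m c (Circuit.encode C) (Circuit.encode C.inv) i ++ T .out))
    (by simp [hk]) (by simp [hkl]) (by simp [hk]) (by simp [hkl])
    (by
      intro i hi a b
      have h₁ : (i + 1) * (m + 1) ≤ k * (m + 1) := Nat.mul_le_mul_right _ hi
      have h₂ : (i + 1) * (m + 1) = i * (m + 1) + m + 1 := by ring
      refine (aux_round (C := C) (w := w) (m := m) (c := c + i * (m + 1)) (B := B) (by simp [hw])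
        (by simp [hwl]) (by simp [hm]) (by simp [hl]) (by simp [hq]) (by simp) (by simp [he])
        (by simp [hr]) (by simp [hd]) (by simp [hb]) hB₁ (by omega) hB₃).congr rfl ?_ le_rfl
      funext r
      cases r <;> simp [strRounds]
      ring)
  refine h.congr ?_ rfl le_rfl
  funext r
  cases r <;> simp [hc, strRounds]

/-- Write the controlled NOTs from the witness to a fresh register, after Hadamard gates if `had`
is true. -/
def emitPairs (had : Bool) : Prog tm :=
  rep .w .wl <|
  seq (seq (emitNum .c) (seq (emitNum .q) (put .out .cnot))) <|
  seq (if had then seq (emitNum .q) (put .out .hadamard) else skip) <|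
  seq (put .q .tick) (put .c .tick)

theorem aux_pairs (had : Bool) {w N B : ℕ} (hw : T .w = ticks w) (hwl : T .wl = [])
    (hq : T .q = []) (hc : T .c = ticks N) (he : T .e = []) (hB : N + w ≤ B) :
    (emitPairs had : Prog tm).Aux T (update (update (update T .q (ticks w)) .c (ticks (N + w))) .out
      (strPairs had N w ++ T .out)) (w * (15 * B + 20) + 2) := by
  have h := aux_rep (tm := tm) (r := .w) (r' := .wl) (n := w) (t := 15 * B + 16)
    (body := seq (seq (emitNum .c) (seq (emitNum .q) (put .out .cnot))) <|
      seq (if had then seq (emitNum .q) (put .out .hadamard) else skip) <|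
      seq (put .q .tick) (put .c .tick)) (by simp)
    (fun i => update (update (update T .q (ticks i)) .c (ticks (N + i))) .out
      (strPairs had N i ++ T .out))
    (by simp [hw]) (by simp [hwl]) (by simp [hw]) (by simp [hwl])
    (by
      intro i hi a b
      let T' := update (update (update (update (update T .q (ticks i)) .c (ticks (N + i))) .out
        (strPairs had N i ++ T .out)) .w a) .wl b
      have h₁ : (seq (emitNum .c) (seq (emitNum .q) (put .out .cnot)) : Prog tm).Emits T'
          (strCnot i (N + i)) (10 * B + 7) := by
        intro o
        refine (((emits_num (B := B) (n := N + i) (by simp) (by simp) (by simp [T'])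
          (by simp [T', he]) (by omega)).seq ((emits_num (B := B) (n := i) (by simp) (by simp)
          (by simp [T']) (by simp [T', he]) (by omega)).seq (emits_put _))) o).congr rfl ?_
          (by omega)
        simp [strCnot]
      have h₂ : (if had then seq (emitNum .q) (put .out .hadamard) else skip : Prog tm).Emits T'
          (if had then strH i else []) (5 * B + 4) := by
        cases had
        · exact fun o => (emits_skip o).mono (by omega)
        · exact (emits_num (B := B) (n := i) (by simp) (by simp)
            (by simp [T']) (by simp [T', he]) (by omega)).seq (emits_put _)
      have h₃ := (h₁ ((strPairs had N i ++ T .out))).seq ((h₂ _).seq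
        ((aux_put .q .tick).seq (aux_put .c .tick)))
      refine h₃.congr ?_ ?_ (by omega)
      · funext r
        cases r <;> simp [T']
      · funext r
        cases r <;> simp [T', strPairs, ← ticks_succ, add_assoc])
  refine h.congr ?_ rfl (by simp [add_assoc])
  funext r
  cases r <;> simp [hq, hc, strPairs]

/-- Write the number of qubits of the verifier on the stack `c`. -/
def putTotal : Prog tm := seq (rep .w .wl (put .c .tick)) (rep .m .ml (put .c .tick))

theorem aux_putTotal {w m : ℕ} (hw : T .w = ticks w) (hwl : T .wl = []) (hm : T .m = ticks m)
    (hl : T .ml = []) (hc : T .c = []) :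
    (putTotal : Prog tm).Aux T (update T .c (ticks (w + m))) (5 * w + 5 * m + 4) := by
  refine ((aux_rep_put (by simp) (by simp) (by simp) hw hwl).seq
    (aux_rep_put (n := m) (by simp) (by simp) (by simp) (by simp [hm]) (by simp [hl]))).congr rfl
    ?_ (by omega)
  simp [hc, add_comm]

/-- Write the circuit that copies the witness and then runs the verifier. -/
def emitCopy : Prog tm :=
  seq emitForward <| seq putTotal <| seq (emitPairs false) <|
  seq (loop .q fun _ => skip) (loop .c fun _ => skip)

theorem aux_copy {n w m B : ℕ} {D : List Symbol} (hB₁ : w + m + w ≤ B) (hB₂ : D.length ≤ B) :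
    (emitCopy : Prog tm).Aux (initRegs n w m D.reverse)
      (update (initRegs n w m D.reverse) .out (strPairs false (w + m) w ++ D))
      (15 * (B * B) + 40 * B + 20) := by
  set T := initRegs n w m D.reverse with hT
  have h₁ := (emits_forward (tm := tm) (T := T) (D := D) rfl rfl hB₂).aux
  have h₂ := aux_putTotal (tm := tm) (T := update T .out D) (w := w) (m := m) (by simp [T, initRegs])
    (by simp [T, initRegs]) (by simp [T, initRegs]) (by simp [T, initRegs]) (by simp [T, initRegs])
  have h₃ := aux_pairs (tm := tm) (T := update (update T .out D) .c (ticks (w + m))) false (w := w)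
    (N := w + m) (B := B) (by simp [T, initRegs]) (by simp [T, initRegs]) (by simp [T, initRegs])
    (by simp) (by simp [T, initRegs]) hB₁
  have h₄ := (aux_clear (tm := tm) (T := update (update (update (update T .out D) .q (ticks w)) .c
    (ticks (w + m + w))) .out (strPairs false (w + m) w ++ D)) .q).seq (aux_clear .c)
  refine ((h₁.congr rfl ?_ le_rfl).seq (h₂.seq ((h₃.congr rfl ?_ le_rfl).seq h₄))).congr rfl ?_ ?_
  · funext r
    cases r <;> simp [T, initRegs]
  · funext r
    cases r <;> simp [T, initRegs]
  · funext r
    cases r <;> simp [T, initRegs]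
  · have : w * (15 * B + 20) ≤ B * (15 * B + 20) := Nat.mul_le_mul_right _ (by omega)
    have e : B * (15 * B + 20) = 15 * (B * B) + 20 * B := by ring
    simp only [ne_eq, reduceCtorEq, not_false_eq_true, update_of_ne, update_self,
      List.length_replicate]
    omega

/-- Write the circuit that decides with maximally mixed witness. -/
def emitAmplify : Prog tm :=
  seq (seq (rep .w .wl (put .k .tick)) (put .k .tick)) <|
  seq putTotal <| seq (rep .w .wl (put .c .tick)) <|
  seq (seq (seq (put .out .sep) (seq (emitNum .c) (put .out .cnot)))
    (seq (emitNum .c) (seq (put .out .sep) (put .out .cnot)))) <|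
  seq (rep .k .kl emitRound) <| seq (emitX .c) <| seq (loop .c fun _ => skip) <|
  seq putTotal <| seq (emitPairs true) <|
  seq (loop .q fun _ => skip) <| seq (loop .c fun _ => skip) (loop .k fun _ => skip)

theorem aux_amplify {N n w m B : ℕ} {C : Circuit N}
    (hB₁ : w + m + w + (w + 1) * (m + 1) ≤ B) (hB₂ : (Circuit.encode C).length ≤ B) :
    (emitAmplify : Prog tm).Aux (initRegs n w m (Circuit.encode C).reverse)
      (update (initRegs n w m (Circuit.encode C).reverse) .out
        (strAmplify w m (Circuit.encode C) (Circuit.encode C.inv)))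
      (100 * B + 50 + B * (roundTime B + 15 * B + 24)) := by
  have hBm : w * 1 ≤ w * (m + 1) := Nat.mul_le_mul_left _ (by omega)
  have hBw : (w + 1) * (m + 1) = w * (m + 1) + (m + 1) := by ring
  set U := Circuit.encode C
  set U' := Circuit.encode C.inv
  set T := initRegs n w m U.reverse with hT
  set c₀ := w + m + w with hc₀
  set c₁ := c₀ + (w + 1) * (m + 1) with hc₁
  -- The contents between the pieces, from the last gates to the first. The counter `c` starts the
  -- rounds at `c₀`, the number of the lowest flag, and leaves them at `c₁`, the number of the top
  -- flag, on which the `X` is written.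
  let T₁ := update T .k (ticks (w + 1))
  let T₂ := update T₁ .c (ticks (w + m))
  let T₃ := update T₁ .c (ticks c₀)
  let s₄ := strCnot 0 c₀ ++ strCnot c₀ 0
  let T₄ := update T₃ .out s₄
  let s₅ := strRounds w m c₀ U U' (w + 1) ++ s₄
  let T₅ := update (update T₁ .c (ticks c₁)) .out s₅
  let T₆ := update (update T₁ .c (ticks c₁)) .out (strX c₁ ++ s₅)
  let T₇ := update T₁ .out (strX c₁ ++ s₅)
  let T₈ := update T₂ .out (strX c₁ ++ s₅)
  let T₉ := update (update (update T₁ .q (ticks w)) .c (ticks c₀)) .out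
    (strAmplify w m U U')
  have hTw : T .w = ticks w := rfl
  have hTm : T .m = ticks m := rfl
  have hTr : T .rev = U.reverse := rfl
  have hT0 : ∀ r : Reg, r ≠ .w → r ≠ .m → r ≠ .n → r ≠ .rev → T r = [] := by
    intro r; cases r <;> simp [T, initRegs]
  have h₁ : (seq (rep .w .wl (put .k .tick)) (put .k .tick) : Prog tm).Aux T T₁ (5 * w + 3) := by
    refine ((aux_rep_put (by simp) (by simp) (by simp) hTw (by simp [hT0])).seq
      (aux_put _ _)).congr rfl ?_ (by omega)
    simp [T₁, hT0, ticks_succ]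
  have h₂ : (putTotal : Prog tm).Aux T₁ T₂ (5 * w + 5 * m + 4) :=
    aux_putTotal (by simp [T₁, hTw]) (by simp [T₁, hT0]) (by simp [T₁, hTm]) (by simp [T₁, hT0])
      (by simp [T₁, hT0])
  have h₃ : (rep .w .wl (put .c .tick) : Prog tm).Aux T₂ T₃ (w * 5 + 2) := by
    refine (aux_rep_put (n := w) (by simp) (by simp) (by simp) (by simp [T₂, T₁, hTw])
      (by simp [T₂, T₁, hT0])).congr rfl ?_ le_rfl
    simp [T₂, T₃, hc₀, add_comm]
  have h₄ : (seq (seq (put .out .sep) (seq (emitNum .c) (put .out .cnot)))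
      (seq (emitNum .c) (seq (put .out .sep) (put .out .cnot))) : Prog tm).Aux T₃ T₄
      (10 * B + 10) := by
    have hn := emits_num (tm := tm) (T := T₃) (r := .c) (n := c₀) (B := B) (by simp) (by simp)
      (by simp [T₃]) (by simp [T₃, T₁, hT0]) (by omega)
    refine (((emits_put _).seq (hn.seq (emits_put _))).seq
      (hn.seq ((emits_put _).seq (emits_put _)))).aux.congr rfl ?_ (by omega)
    simp [T₄, s₄, strCnot, T₃, T₁, hT0]
    rfl
  have h₅ : (rep .k .kl emitRound : Prog tm).Aux T₄ T₅ ((w + 1) * (roundTime B + 4) + 2) := by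
    refine (aux_rounds (C := C) (w := w) (m := m) (c := c₀) (k := w + 1) (B := B)
      (by simp [T₄, T₃, T₁, hTw]) (by simp [T₄, T₃, T₁, hT0]) (by simp [T₄, T₃, T₁, hTm])
      (by simp [T₄, T₃, T₁, hT0]) (by simp [T₄, T₃, T₁]) (by simp [T₄, T₃, T₁, hT0])
      (by simp [T₄, T₃, T₁, hT0]) (by simp [T₄, T₃]) (by simp [T₄, T₃, T₁, hT0])
      (by simp [T₄, T₃, T₁, hTr, U]) (by simp [T₄, T₃, T₁, hT0])
      (by simp [T₄, T₃, T₁, hT0]) (by omega) (by omega) hB₂).congr rfl ?_ le_rfl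
    funext r
    cases r <;> simp [T₅, T₄, T₃, s₅, c₁, U, U']
  have h₆ : (emitX .c : Prog tm).Aux T₅ T₆ (5 * B + 4) := by
    refine (emits_x (n := c₁) (by simp) (by simp) (by simp [T₅]) (by simp [T₅, T₁, hT0])
      (by omega)).aux.congr rfl ?_ le_rfl
    simp [T₅, T₆]
  have h₇ : (loop .c (fun _ => skip) : Prog tm).Aux T₆ T₇ (2 * c₁ + 1) := by
    refine (aux_clear _).congr rfl ?_ (by simp [T₆])
    funext r
    cases r <;> simp [T₆, T₇, T₁, hT0]
  have h₈ : (putTotal : Prog tm).Aux T₇ T₈ (5 * w + 5 * m + 4) := by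
    refine (aux_putTotal (w := w) (m := m) (by simp [T₇, T₁, hTw]) (by simp [T₇, T₁, hT0])
      (by simp [T₇, T₁, hTm]) (by simp [T₇, T₁, hT0]) (by simp [T₇, T₁, hT0])).congr rfl ?_ le_rfl
    funext r
    cases r <;> simp [T₇, T₈, T₂]
  have h₉ : (emitPairs true : Prog tm).Aux T₈ T₉ (w * (15 * B + 20) + 2) := by
    refine (aux_pairs true (w := w) (N := w + m) (by simp [T₈, T₂, T₁, hTw])
      (by simp [T₈, T₂, T₁, hT0]) (by simp [T₈, T₂, T₁, hT0]) (by simp [T₈, T₂])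
      (by simp [T₈, T₂, T₁, hT0]) (by omega)).congr rfl ?_ le_rfl
    funext r
    cases r <;> simp [T₉, T₈, T₂, c₀, s₅, s₄, strAmplify, c₁]
  have h₁₀ := (aux_clear (tm := tm) (T := T₉) .q).seq ((aux_clear .c).seq (aux_clear .k))
  refine (h₁.seq (h₂.seq (h₃.seq (h₄.seq (h₅.seq (h₆.seq (h₇.seq (h₈.seq (h₉.seq
    h₁₀))))))))).congr rfl ?_ ?_
  · funext r
    cases r <;> simp [T₉, T₁, hT0]
  · have e₁ : w * (15 * B + 20) ≤ B * (15 * B + 20) := Nat.mul_le_mul_right _ (by omega)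
    have e₂ : (w + 1) * (roundTime B + 4) ≤ B * (roundTime B + 4) :=
      Nat.mul_le_mul_right _ (by omega)
    have e₃ : B * (roundTime B + 15 * B + 24) = B * (roundTime B + 4) + B * (15 * B + 20) := by
      ring
    simp only [T₉, T₁, ne_eq, reduceCtorEq, not_false_eq_true, update_of_ne, update_self,
      List.length_replicate]
    omega

end Prog

/-! ### Uniformity -/

theorem uniform_of_strPairs {w m : Polynomial ℕ} {N N' : ℕ → ℕ}
    {Q : ∀ x : List Bool, Circuit (N x.length)} {Q' : ∀ x : List Bool, Circuit (N' x.length)}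
    (h : Uniform Q)
    (hQ' : ∀ x, Circuit.encode (Q' x) =
      strPairs false (w.eval x.length + m.eval x.length) (w.eval x.length) ++
        Circuit.encode (Q x)) :
    Uniform Q' := by
  obtain ⟨h⟩ := h
  obtain ⟨L, hL, hlen⟩ := polyBdd_length h
  -- A common bound for all qubit numbers that occur and for the length of the given description.
  let B : ℕ → ℕ := fun n => w.eval n + m.eval n + w.eval n + L n
  have hB : PolyBdd B := .add (.add (.add (.eval w) (.eval m)) (.eval w)) hL
  refine nonempty_computable_of_prog w m h Prog.emitCopy
    (t := fun n => 15 * (B n * B n) + 40 * B n + 20) ?_ fun x => ?_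
  · exact .add (.add (.mul (.const 15) (.mul hB hB)) (.mul (.const 40) hB)) (.const 20)
  · rw [hQ']
    exact Prog.aux_copy (Nat.le_add_right _ _) ((hlen x).trans (Nat.le_add_left _ _))

theorem uniform_of_strAmplify {w m : Polynomial ℕ} {N N' : ℕ → ℕ}
    {Q : ∀ x : List Bool, Circuit (N x.length)} {Q' : ∀ x : List Bool, Circuit (N' x.length)}
    (h : Uniform Q)
    (hQ' : ∀ x, Circuit.encode (Q' x) =
      strAmplify (w.eval x.length) (m.eval x.length) (Circuit.encode (Q x))
        (Circuit.encode (Q x).inv)) :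
    Uniform Q' := by
  obtain ⟨h⟩ := h
  obtain ⟨L, hL, hlen⟩ := polyBdd_length h
  let B : ℕ → ℕ := fun n =>
    w.eval n + m.eval n + w.eval n + (w.eval n + 1) * (m.eval n + 1) + L n
  have hB : PolyBdd B := .add (.add (.add (.add (.eval w) (.eval m)) (.eval w))
    (.mul (.add (.eval w) (.const 1)) (.add (.eval m) (.const 1)))) hL
  refine nonempty_computable_of_prog w m h Prog.emitAmplify
    (t := fun n => 100 * B n + 50 + B n * (Prog.roundTime (B n) + 15 * B n + 24)) ?_ fun x => ?_
  · exact .add (.add (.mul (.const 100) hB) (.const 50)) (.mul hB (.add (.add (.add (.add (.mul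
      (.const 27) (.mul hB hB)) (.mul (.const 70) hB)) (.const 40)) (.mul (.const 15) hB))
      (.const 24)))
  · rw [hQ']
    exact Prog.aux_amplify (Nat.le_add_right _ _) ((hlen x).trans (Nat.le_add_left _ _))

end SBQPMerlin

/-! ### Linear algebra of circuits. -/

namespace SBQPMerlin

open scoped ComplexOrder
open Function Matrix

/-! ### The action of circuits on vectors -/

section Action

variable {N R : ℕ}

theorem toOp_append_mulVec (C D : Circuit N) (v : (Fin N → Bool) → ℂ) :
    Circuit.toOp (C ++ D) *ᵥ v = Circuit.toOp D *ᵥ (Circuit.toOp C *ᵥ v) := by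
  induction C generalizing v with
  | nil => simp [Circuit.toOp]
  | cons g C ih =>
    rw [List.cons_append, Circuit.toOp, Circuit.toOp, ← mulVec_mulVec, ih, mulVec_mulVec v]

theorem toOp_cons_mulVec (g : Gate N) (C : Circuit N) (v : (Fin N → Bool) → ℂ) :
    Circuit.toOp (g :: C) *ᵥ v = Circuit.toOp C *ᵥ (g.toOp *ᵥ v) := by
  rw [Circuit.toOp, mulVec_mulVec]

theorem toOp_nil_mulVec (v : (Fin N → Bool) → ℂ) :
    Circuit.toOp ([] : Circuit N) *ᵥ v = v := by
  rw [Circuit.toOp, one_mulVec]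

theorem toOp_append (C D : Circuit N) :
    Circuit.toOp (C ++ D) = Circuit.toOp D * Circuit.toOp C := by
  induction C with
  | nil => simp [Circuit.toOp]
  | cons g C ih => rw [List.cons_append, Circuit.toOp, Circuit.toOp, ih, mul_assoc]

/-- The flip is an involution because `f` ignores the target. Hence the permutation matrix is
symmetric and acts on vectors by composition with the flip itself. -/
theorem eq_update_xor_iff {f : (Fin N → Bool) → Bool} {t : Fin N}
    (hf : ∀ j b, f (update j t b) = f j) (i j : Fin N → Bool) :
    i = update j t (xor (j t) (f j)) ↔ j = update i t (xor (i t) (f i)) := by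
  constructor
  · rintro rfl
    simp [hf]
  · rintro rfl
    simp [hf]

theorem controlledFlip_mulVec {f : (Fin N → Bool) → Bool} {t : Fin N}
    (hf : ∀ j b, f (update j t b) = f j) (v : (Fin N → Bool) → ℂ) (i : Fin N → Bool) :
    (controlledFlip f t *ᵥ v) i = v (update i t (xor (i t) (f i))) := by
  simp only [controlledFlip, mulVec, dotProduct, of_apply]
  rw [Finset.sum_eq_single (update i t (xor (i t) (f i)))]
  · rw [if_pos ((eq_update_xor_iff hf _ _).2 rfl), one_mul]
  · intro j _ hj
    rw [if_neg fun h => hj ((eq_update_xor_iff hf _ _).1 h), zero_mul]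
  · intro h
    exact absurd (Finset.mem_univ _) h

theorem onQubit_mulVec (A : Matrix Bool Bool ℂ) (t : Fin N) (v : (Fin N → Bool) → ℂ)
    (i : Fin N → Bool) :
    (onQubit A t *ᵥ v) i = ∑ b, A (i t) b * v (update i t b) := by
  simp only [onQubit, mulVec, dotProduct, of_apply, ite_mul, zero_mul]
  rw [← Finset.sum_filter]
  symm
  refine Finset.sum_bij (fun b _ => update i t b) ?_ ?_ ?_ ?_
  · intro b _
    simp only [Finset.mem_filter, Finset.mem_univ, true_and]
    intro p hp
    rw [update_of_ne hp]
  · intro b _ b' _ h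
    simpa using congrFun h t
  · intro j hj
    simp only [Finset.mem_filter, Finset.mem_univ, true_and] at hj
    refine ⟨j t, Finset.mem_univ _, ?_⟩
    funext p
    by_cases hp : p = t
    · subst hp; simp
    · rw [update_of_ne hp, hj p hp]
  · intro b _
    simp

theorem toOp_pauliX_mulVec (t : Fin N) (v : (Fin N → Bool) → ℂ) (i : Fin N → Bool) :
    ((Gate.pauliX t).toOp *ᵥ v) i = v (update i t (!i t)) := by
  rw [Gate.toOp, controlledFlip_mulVec (fun _ _ => rfl)]
  simp

theorem toOp_cnot_mulVec {c t : Fin N} (h : c ≠ t) (v : (Fin N → Bool) → ℂ) (i : Fin N → Bool) :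
    ((Gate.cnot c t h).toOp *ᵥ v) i = v (update i t (xor (i t) (i c))) :=
  controlledFlip_mulVec (fun j b => by simp [h]) v i

theorem toOp_toffoli_mulVec {a b t : Fin N} (hab : a ≠ b) (hat : a ≠ t) (hbt : b ≠ t)
    (v : (Fin N → Bool) → ℂ) (i : Fin N → Bool) :
    ((Gate.toffoli a b t hab hat hbt).toOp *ᵥ v) i = v (update i t (xor (i t) (i a && i b))) :=
  controlledFlip_mulVec (fun j b => by simp [hat, hbt]) v i

theorem append_inj {a a' : Fin N → Bool} {b b' : Fin R → Bool} :
    Fin.append a b = Fin.append a' b' ↔ a = a' ∧ b = b' := by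
  constructor
  · intro h
    exact ⟨funext fun p => by simpa using congrFun h (Fin.castAdd R p),
      funext fun p => by simpa using congrFun h (Fin.natAdd N p)⟩
  · rintro ⟨rfl, rfl⟩; rfl

theorem update_append_castAdd (a : Fin N → Bool) (b : Fin R → Bool) (q : Fin N) (x : Bool) :
    update (Fin.append a b) (Fin.castAdd R q) x = Fin.append (update a q x) b := by
  funext p
  refine Fin.addCases (fun p => ?_) (fun p => ?_) p
  · by_cases h : p = q
    · subst h; simp
    · rw [update_of_ne (by simpa using h)]; simp [h]
  · rw [update_of_ne (by simp [Fin.ext_iff]; omega)]; simp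

theorem update_append_natAdd (a : Fin N → Bool) (b : Fin R → Bool) (q : Fin R) (x : Bool) :
    update (Fin.append a b) (Fin.natAdd N q) x = Fin.append a (update b q x) := by
  funext p
  refine Fin.addCases (fun p => ?_) (fun p => ?_) p
  · rw [update_of_ne (by simp [Fin.ext_iff]; omega)]; simp
  · by_cases h : p = q
    · subst h; simp
    · rw [update_of_ne (by simpa using h)]; simp [h]

theorem sum_append {M : Type*} [AddCommMonoid M] (f : (Fin (N + R) → Bool) → M) :
    ∑ i, f i = ∑ a : Fin N → Bool, ∑ b : Fin R → Bool, f (Fin.append a b) := by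
  rw [← Fintype.sum_prod_type', ← (Fin.appendEquiv N R).sum_comp]
  rfl

/-- A gate on the first `N` of `N + R` qubits. -/
def Gate.lift (R : ℕ) : Gate N → Gate (N + R)
  | .pauliX t => .pauliX (Fin.castAdd R t)
  | .hadamard t => .hadamard (Fin.castAdd R t)
  | .tGate t => .tGate (Fin.castAdd R t)
  | .tInv t => .tInv (Fin.castAdd R t)
  | .cnot c t h => .cnot (Fin.castAdd R c) (Fin.castAdd R t) ((Fin.castAdd_injective N R).ne h)
  | .toffoli a b t hab hat hbt => .toffoli (Fin.castAdd R a) (Fin.castAdd R b) (Fin.castAdd R t)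
      ((Fin.castAdd_injective N R).ne hab) ((Fin.castAdd_injective N R).ne hat)
      ((Fin.castAdd_injective N R).ne hbt)

/-- A circuit on the first `N` of `N + R` qubits. -/
def Circuit.lift (R : ℕ) (C : Circuit N) : Circuit (N + R) := C.map (Gate.lift R)

theorem Circuit.encode_lift (C : Circuit N) : (Circuit.lift R C).encode = C.encode := by
  induction C with
  | nil => rfl
  | cons g C ih =>
    have h : (g.lift R).encode = g.encode := by cases g <;> rfl
    have e : Circuit.lift R (g :: C) = g.lift R :: Circuit.lift R C := rfl
    rw [e, Circuit.encode_cons, Circuit.encode_cons, ih, h]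

/-- The added qubits are spectators: for each value `b` of theirs, the gate acts on the slice of `v`
at `b`. -/
theorem Gate.toOp_lift_mulVec (g : Gate N) (v : (Fin (N + R) → Bool) → ℂ) (a : Fin N → Bool)
    (b : Fin R → Bool) :
    ((g.lift R).toOp *ᵥ v) (Fin.append a b) = (g.toOp *ᵥ fun a' => v (Fin.append a' b)) a := by
  have h₁ : ∀ A (t : Fin N), (onQubit A (Fin.castAdd R t) *ᵥ v) (Fin.append a b) =
      (onQubit A t *ᵥ fun a' => v (Fin.append a' b)) a := by
    intro A t
    simp only [onQubit_mulVec, update_append_castAdd, Fin.append_left]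
  cases g with
  | pauliX t =>
    simp only [Gate.lift, toOp_pauliX_mulVec, update_append_castAdd, Fin.append_left]
  | hadamard t => exact h₁ _ t
  | tGate t => exact h₁ _ t
  | tInv t => exact h₁ _ t
  | cnot c t h => simp only [Gate.lift, toOp_cnot_mulVec, update_append_castAdd, Fin.append_left]
  | toffoli =>
    simp only [Gate.lift, toOp_toffoli_mulVec, update_append_castAdd, Fin.append_left]

theorem Circuit.toOp_lift_mulVec (C : Circuit N) (v : (Fin (N + R) → Bool) → ℂ)
    (a : Fin N → Bool) (b : Fin R → Bool) :
    (Circuit.toOp (C.lift R) *ᵥ v) (Fin.append a b) =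
      (C.toOp *ᵥ fun a' => v (Fin.append a' b)) a := by
  induction C generalizing v a with
  | nil => simp [Circuit.lift, Circuit.toOp]
  | cons g C ih =>
    have e : Circuit.lift R (g :: C) = g.lift R :: Circuit.lift R C := rfl
    rw [e, toOp_cons_mulVec, toOp_cons_mulVec, ih]
    congr 2
    funext a'
    rw [Gate.toOp_lift_mulVec]

theorem controlledFlip_conjTranspose {f : (Fin N → Bool) → Bool} {t : Fin N}
    (hf : ∀ j b, f (update j t b) = f j) : (controlledFlip f t)ᴴ = controlledFlip f t := by
  ext i j
  simp only [controlledFlip, conjTranspose_apply, of_apply, eq_update_xor_iff hf j i]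
  split_ifs <;> simp

theorem onQubit_conjTranspose (A : Matrix Bool Bool ℂ) (t : Fin N) :
    (onQubit A t)ᴴ = onQubit Aᴴ t := by
  ext i j
  simp only [onQubit, conjTranspose_apply, of_apply]
  by_cases h : ∀ p, p ≠ t → i p = j p
  · rw [if_pos h, if_pos fun p hp => (h p hp).symm]
  · rw [if_neg h, if_neg fun h' => h fun p hp => (h' p hp).symm, star_zero]

theorem phaseMatrix_conjTranspose (z : ℂ) : (phaseMatrix z)ᴴ = phaseMatrix (star z) := by
  rw [phaseMatrix, phaseMatrix, diagonal_conjTranspose]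
  congr 1
  funext a
  cases a <;> simp

theorem hadamardMatrix_conjTranspose : hadamardMatrixᴴ = hadamardMatrix := by
  ext a b
  cases a <;> cases b <;> simp [hadamardMatrix]

theorem Gate.toOp_inv (g : Gate N) : g.inv.toOp = g.toOpᴴ := by
  have h4 : (starRingEnd ℂ) 4 = 4 := Complex.conj_ofNat 4
  cases g with
  | pauliX t => exact (controlledFlip_conjTranspose fun _ _ => rfl).symm
  | hadamard t =>
    simp only [Gate.inv, Gate.toOp, onQubit_conjTranspose, hadamardMatrix_conjTranspose]
  | tGate t =>
    simp only [Gate.inv, Gate.toOp, onQubit_conjTranspose, phaseMatrix_conjTranspose]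
    congr 2
    simp only [RCLike.star_def, ← Complex.exp_conj]
    simp [h4, neg_div]
  | tInv t =>
    simp only [Gate.inv, Gate.toOp, onQubit_conjTranspose, phaseMatrix_conjTranspose]
    congr 2
    simp only [RCLike.star_def, ← Complex.exp_conj]
    simp [h4, neg_div]
  | cnot c t h => exact (controlledFlip_conjTranspose fun j b => by simp [h]).symm
  | toffoli a b t _ hat hbt =>
    exact (controlledFlip_conjTranspose fun j b => by simp [hat, hbt]).symm

theorem Circuit.toOp_inv (C : Circuit N) : C.inv.toOp = C.toOpᴴ := by
  induction C with
  | nil => simp [Circuit.inv, Circuit.toOp]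
  | cons g C ih =>
    rw [Circuit.inv, toOp_append, ih, Circuit.toOp, Circuit.toOp, Circuit.toOp, conjTranspose_mul,
      one_mul, Gate.toOp_inv]

end Action

/-! ### Acceptance operators -/

/-- The bit string `y`, padded with zeros to length `N`. -/
def pad {w : ℕ} (N : ℕ) (y : Fin w → Bool) : Fin N → Bool :=
  fun p => if h : p.val < w then y ⟨p, h⟩ else false

theorem pad_injective {w N : ℕ} (h : w ≤ N) : Injective (pad N : (Fin w → Bool) → _) := by
  intro y z e
  funext p
  simpa [pad] using congrFun e ⟨p, by omega⟩

theorem pad_add {w N R : ℕ} (h : w ≤ N) (y : Fin w → Bool) :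
    pad (N + R) y = Fin.append (pad N y) fun _ => false := by
  funext p
  refine Fin.addCases (fun p => ?_) (fun p => ?_) p
  · simp [pad]
  · simp [pad]; omega

/-- The isometry that adds ancillas in the state `|0⟩` to a `w`-qubit register. -/
noncomputable def embedding (w N : ℕ) : Matrix (Fin N → Bool) (Fin w → Bool) ℂ :=
  Matrix.of fun i y => if i = pad N y then 1 else 0

theorem embedding_conjTranspose_mul_self {w N : ℕ} (h : w ≤ N) :
    (embedding w N)ᴴ * embedding w N = 1 := by
  ext y z
  simp only [mul_apply, conjTranspose_apply, embedding, of_apply, one_apply, apply_ite star,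
    star_one, star_zero, ite_mul, one_mul, zero_mul, Finset.sum_ite_eq', Finset.mem_univ, if_true,
    (pad_injective h).eq_iff]

/-- The operator `A` on witnesses such that the circuit `C` accepts a witness `ξ` with probability
`tr (A ξ)`. -/
noncomputable def acceptOp (w : ℕ) {N : ℕ} (C : Circuit N) : Op w :=
  (embedding w N)ᴴ * (C.toOpᴴ * (acceptProj N * (C.toOp * embedding w N)))

/-- Adding ancillas is conjugation by an isometry; by cyclicity of the trace it can then be absorbed
into `acceptOp`. -/
theorem tensor_zeroState {w m : ℕ} (ξ : Op w) :
    tensor ξ (zeroState m) = embedding w (w + m) * ξ * (embedding w (w + m))ᴴ := by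
  have hp : ∀ y : Fin w → Bool, pad (w + m) y = Fin.append y fun _ => false := by
    intro y
    rw [pad_add le_rfl]
    congr 1
    funext p
    simp [pad]
  ext i j
  obtain ⟨⟨a, b⟩, rfl⟩ := (Fin.appendEquiv w m).surjective i
  obtain ⟨⟨a', b'⟩, rfl⟩ := (Fin.appendEquiv w m).surjective j
  simp only [Fin.appendEquiv, Equiv.coe_fn_mk, tensor, of_apply, Fin.append_left, Fin.append_right,
    mul_apply, conjTranspose_apply, embedding, hp, append_inj, zeroState, basisState,
    Matrix.single_apply, ite_and, ite_mul, one_mul, zero_mul, Finset.sum_ite_eq, Finset.mem_univ,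
    if_true, apply_ite star, star_one, star_zero, mul_ite, mul_one, mul_zero]
  by_cases hb : b = fun _ => false <;> by_cases hb' : b' = fun _ => false <;>
    simp [hb, hb', eq_comm]

theorem acceptProb_tensor {w m : ℕ} (C : Circuit (w + m)) (ξ : Op w) :
    acceptProb C (tensor ξ (zeroState m)) = (acceptOp w C * ξ).trace.re := by
  rw [acceptProb, tensor_zeroState, acceptOp]
  congr 1
  simp only [← Matrix.mul_assoc]
  rw [Matrix.trace_mul_comm]
  simp only [← Matrix.mul_assoc]
  rw [Matrix.trace_mul_comm]
  simp only [← Matrix.mul_assoc]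

theorem posSemidef_acceptOp (w : ℕ) {N : ℕ} (C : Circuit N) : (acceptOp w C).PosSemidef := by
  have h : (acceptProj N).PosSemidef := by
    refine PosSemidef.diagonal fun i => ?_
    simp only [Pi.zero_apply]
    split_ifs <;> simp
  have := h.conjTranspose_mul_mul_same (C.toOp * embedding w N)
  simpa only [acceptOp, conjTranspose_mul, Matrix.mul_assoc] using this

/-- Entries are inner products of the accepting parts of the final vectors for two basis witnesses.
This reduces later computations of `acceptOp` to basis inputs. -/
theorem acceptOp_apply (w : ℕ) {N : ℕ} (C : Circuit N) (z y : Fin w → Bool) :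
    acceptOp w C z y = ∑ i, if outputBit i then
      star ((C.toOp *ᵥ Pi.single (pad N z) 1) i) * (C.toOp *ᵥ Pi.single (pad N y) 1) i else 0 := by
  have h : ∀ i y, (C.toOp * embedding w N) i y = (C.toOp *ᵥ Pi.single (pad N y) 1) i := by
    intro i y
    simp [mul_apply, embedding, mulVec_single]
  rw [acceptOp, ← Matrix.mul_assoc, ← conjTranspose_mul, mul_apply]
  refine Finset.sum_congr rfl fun i _ => ?_
  rw [acceptProj, diagonal_mul, conjTranspose_apply, h, h]
  split_ifs <;> simp

end SBQPMerlin

namespace SBQPMerlin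

open scoped ComplexOrder
open Function Matrix

/-! ### Traces of powers of acceptance operators -/

section Trace

variable {N : ℕ} {M U : Op N} {ev : (Fin N → Bool) → ℝ}

theorem exists_diagonalization (hM : M.PosSemidef) :
    ∃ (U : Op N) (ev : (Fin N → Bool) → ℝ), star U * U = 1 ∧ U * star U = 1 ∧ (∀ i, 0 ≤ ev i) ∧
      M = U * diagonal (fun i => (ev i : ℂ)) * star U :=
  ⟨hM.isHermitian.eigenvectorUnitary, hM.isHermitian.eigenvalues,
    Unitary.coe_star_mul_self hM.isHermitian.eigenvectorUnitary,
    Unitary.coe_mul_star_self hM.isHermitian.eigenvectorUnitary, hM.eigenvalues_nonneg, by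
      conv_lhs => rw [hM.isHermitian.spectral_theorem, Unitary.conjStarAlgAut_apply]
      rfl⟩

theorem re_trace_pow (hU : star U * U = 1) (hU' : U * star U = 1)
    (hM : M = U * diagonal (fun i => (ev i : ℂ)) * star U) (k : ℕ) :
    (M ^ k).trace.re = ∑ i, ev i ^ k := by
  have h : M ^ k = U * diagonal (fun i => ((ev i ^ k : ℝ) : ℂ)) * star U := by
    induction k with
    | zero => simp [hU']
    | succ k ih =>
      rw [pow_succ, ih, hM]
      calc U * diagonal (fun i => ((ev i ^ k : ℝ) : ℂ)) * star U *
            (U * diagonal (fun i => (ev i : ℂ)) * star U)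
          = U * (diagonal (fun i => ((ev i ^ k : ℝ) : ℂ)) * (star U * U) *
            diagonal (fun i => (ev i : ℂ))) * star U := by simp only [mul_assoc]
        _ = _ := by
          rw [hU, mul_one, diagonal_mul_diagonal]
          simp [pow_succ]
  rw [h, mul_assoc, trace_mul_comm, mul_assoc, hU, mul_one, trace_diagonal]
  simp only [Complex.re_sum, Complex.ofReal_re]

/-- In the eigenbasis the trace is an average of the eigenvalues, weighted by the diagonal of the
rotated state, and an average cannot exceed all of its terms. -/
theorem exists_trace_mul_le_eigenvalue (hU' : U * star U = 1)
    (hM : M = U * diagonal (fun i => (ev i : ℂ)) * star U) {ξ : Op N} (hξ : IsState ξ) :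
    ∃ i, (M * ξ).trace.re ≤ ev i := by
  set σ : Op N := star U * ξ * U with hσ
  have hpos : σ.PosSemidef := hξ.1.conjTranspose_mul_mul_same U
  have htr : ∑ i, (σ i i).re = 1 := by
    have h : σ.trace = 1 := by
      rw [hσ, trace_mul_comm, ← mul_assoc, hU', one_mul, hξ.2]
    have := congrArg Complex.re h
    simpa [trace] using this
  have hMξ : (M * ξ).trace.re = ∑ i, ev i * (σ i i).re := by
    have h : (M * ξ).trace = (diagonal (fun i => (ev i : ℂ)) * σ).trace := by
      rw [hM, hσ, mul_assoc, mul_assoc, trace_mul_comm]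
      simp only [mul_assoc]
    rw [h]
    simp [trace, diagonal_mul]
  by_contra! hlt
  rw [hMξ] at hlt
  set t := ∑ i, ev i * (σ i i).re with ht
  have hnn : ∀ i, 0 ≤ (σ i i).re := fun i => (Complex.le_def.1 (hpos.diag_nonneg (i := i))).1
  obtain ⟨j, -, hj⟩ : ∃ j ∈ Finset.univ, (0 : ℝ) < (σ j j).re := by
    apply Finset.exists_lt_of_sum_lt
    simp [htr]
  have : t < t := by
    calc t < ∑ i, t * (σ i i).re :=
          Finset.sum_lt_sum (fun i _ => mul_le_mul_of_nonneg_right (hlt i).le (hnn i))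
            ⟨j, Finset.mem_univ j, mul_lt_mul_of_pos_right (hlt j) hj⟩
      _ = t := by rw [← Finset.mul_sum, htr, mul_one]
  exact lt_irrefl _ this

/-- The state is the projection onto an eigenvector. -/
theorem exists_state_trace_mul_eq_eigenvalue (hU : star U * U = 1)
    (hM : M = U * diagonal (fun i => (ev i : ℂ)) * star U) (i : Fin N → Bool) :
    ∃ ξ : Op N, IsState ξ ∧ (M * ξ).trace.re = ev i := by
  have hE : (diagonal (Pi.single i 1 : (Fin N → Bool) → ℂ)).PosSemidef :=
    PosSemidef.diagonal fun j => by
      by_cases h : j = i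
      · subst h; simp
      · simp [h]
  refine ⟨U * diagonal (Pi.single i 1) * star U, ⟨hE.mul_mul_conjTranspose_same U, ?_⟩, ?_⟩
  · rw [mul_assoc, trace_mul_comm, mul_assoc, hU, mul_one, trace_diagonal]
    simp
  · have e : M * (U * diagonal (Pi.single i 1) * star U) =
        U * (diagonal (fun i => (ev i : ℂ)) * (star U * U) * diagonal (Pi.single i 1) * star U) := by
      rw [hM]
      simp only [mul_assoc]
    rw [e, hU, mul_one, trace_mul_comm, mul_assoc, hU, mul_one, diagonal_mul_diagonal,
      trace_diagonal]
    simp [Pi.single_apply]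

theorem pow_le_re_trace_pow (hM : M.PosSemidef) {ξ : Op N} (hξ : IsState ξ) {t : ℝ} (ht : 0 ≤ t)
    (h : t ≤ (M * ξ).trace.re) (k : ℕ) : t ^ k ≤ (M ^ k).trace.re := by
  obtain ⟨U, ev, hU, hU', hev, hM⟩ := exists_diagonalization hM
  obtain ⟨i, hi⟩ := exists_trace_mul_le_eigenvalue hU' hM hξ
  rw [re_trace_pow hU hU' hM]
  calc t ^ k ≤ ev i ^ k := pow_le_pow_left₀ ht (h.trans hi) k
    _ ≤ _ := Finset.single_le_sum (f := fun i => ev i ^ k)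
      (fun j _ => pow_nonneg (hev j) k) (Finset.mem_univ i)

/-- Eigenvectors are states, so `t` bounds every eigenvalue; the factor counts the eigenvalues. -/
theorem re_trace_pow_le (hM : M.PosSemidef) {t : ℝ}
    (h : ∀ ξ : Op N, IsState ξ → (M * ξ).trace.re ≤ t) (k : ℕ) :
    (M ^ k).trace.re ≤ 2 ^ N * t ^ k := by
  obtain ⟨U, ev, hU, hU', hev, hM⟩ := exists_diagonalization hM
  rw [re_trace_pow hU hU' hM]
  calc ∑ i, ev i ^ k ≤ ∑ _i : Fin N → Bool, t ^ k := by
        refine Finset.sum_le_sum fun i _ => ?_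
        obtain ⟨ξ, hξ, e⟩ := exists_state_trace_mul_eq_eigenvalue hU hM i
        exact pow_le_pow_left₀ (hev i) (e ▸ h ξ hξ) k
    _ = 2 ^ N * t ^ k := by simp

end Trace

end SBQPMerlin

/-! ### Acceptance on basis states and with idle qubits. -/

namespace SBQPMerlin

open scoped ComplexOrder
open Function Matrix

theorem outputBit_append {N R : ℕ} (hN : 0 < N) (a : Fin N → Bool) (b : Fin R → Bool) :
    outputBit (Fin.append a b) = a ⟨0, hN⟩ := by
  have h : 0 < N + R := by omega
  rw [outputBit, dif_pos h]
  exact Fin.append_left a b ⟨0, hN⟩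

theorem acceptProb_basisState {N : ℕ} (C : Circuit N) (z : Fin N → Bool) :
    acceptProb C (basisState z) =
      ∑ i, if outputBit i then Complex.normSq ((C.toOp *ᵥ Pi.single z 1) i) else 0 := by
  have h : ∀ i, (C.toOp * basisState z * C.toOpᴴ) i i =
      (C.toOp *ᵥ Pi.single z 1) i * star ((C.toOp *ᵥ Pi.single z 1) i) := by
    intro i
    have e : basisState z = vecMulVec (Pi.single z 1) (star (Pi.single z 1)) := by
      ext a b
      simp only [basisState, Matrix.single_apply, vecMulVec_apply, Pi.star_apply, Pi.single_apply,
        apply_ite star, star_one, star_zero, mul_ite, mul_one, mul_zero, ite_and]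
      by_cases ha : a = z <;> by_cases hb : b = z <;> simp [ha, hb, eq_comm (a := z)]
    rw [e, mul_vecMulVec, vecMulVec_mul, ← star_mulVec, vecMulVec_apply, Pi.star_apply]
  rw [acceptProb, acceptProj, trace]
  simp only [Matrix.diag_apply, diagonal_mul, h, Complex.re_sum]
  refine Finset.sum_congr rfl fun i _ => ?_
  split_ifs
  · rw [one_mul, RCLike.star_def, Complex.mul_conj, Complex.ofReal_re]
  · simp

theorem acceptProb_zeroState {N : ℕ} (C : Circuit N) (y : Fin 0 → Bool) :
    acceptProb C (zeroState N) = (acceptOp 0 C y y).re := by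
  have hp : pad N y = fun _ => false := by
    funext p; simp [pad]
  rw [zeroState, acceptProb_basisState, acceptOp_apply, hp, Complex.re_sum]
  refine Finset.sum_congr rfl fun i _ => ?_
  split_ifs
  · rw [RCLike.star_def, ← Complex.normSq_eq_conj_mul_self, Complex.ofReal_re]
  · simp

/-- The idle qubits stay 0, so only their zero slice contributes. This permits adding an ancilla to
make sure that qubit 0 exists. -/
theorem acceptOp_lift {w N R : ℕ} (h : w ≤ N) (C : Circuit N) :
    acceptOp w (C.lift R) = acceptOp w C := by
  ext z y
  have hcol : ∀ (y : Fin w → Bool) a b,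
      (Circuit.toOp (C.lift R) *ᵥ Pi.single (pad (N + R) y) 1) (Fin.append a b) =
        if b = fun _ => false then (C.toOp *ᵥ Pi.single (pad N y) 1) a else 0 := by
    intro y a b
    rw [Circuit.toOp_lift_mulVec]
    split_ifs with hb
    · congr 2
      funext a'
      simp [pad_add h, Pi.single_apply, append_inj, hb]
    · have : (fun a' => (Pi.single (pad (N + R) y) 1 : (Fin (N + R) → Bool) → ℂ)
          (Fin.append a' b)) = 0 := by
        funext a'
        simp [pad_add h, append_inj, hb]
      rw [this, mulVec_zero, Pi.zero_apply]
  rw [acceptOp_apply, acceptOp_apply, sum_append]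
  refine Finset.sum_congr rfl fun a _ => ?_
  rw [Finset.sum_eq_single fun _ => false]
  · rw [hcol, hcol, if_pos rfl, if_pos rfl]
    -- For `N = 0` there are no gates. If the lifted register has an output qubit, it is an idle
    -- qubit in state 0, which agrees with the convention for empty registers.
    rcases Nat.eq_zero_or_pos N with rfl | hN
    · have hC : C = [] := by
        cases C with
        | nil => rfl
        | cons g C => cases g with | _ t => exact t.elim0
      have hw : w = 0 := by omega
      subst hw hC
      have h₁ : outputBit a = false := rfl
      by_cases hR : 0 < 0 + R
      · have h₂ : outputBit (Fin.append a fun _ : Fin R => false) = false := by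
          rw [outputBit, dif_pos hR]
          obtain ⟨R, rfl⟩ := Nat.exists_eq_succ_of_ne_zero (n := R) (by omega)
          exact Fin.append_right a _ 0
        rw [h₁, h₂]
      · have h₂ : outputBit (Fin.append a fun _ : Fin R => false) = false := by
          rw [outputBit, dif_neg hR]
        rw [h₁, h₂]
    · have h₁ : outputBit a = a ⟨0, hN⟩ := dif_pos hN
      rw [outputBit_append hN, h₁]
  · intro b _ hb
    rw [hcol, hcol, if_neg hb]
    simp
  · intro hb
    exact absurd (Finset.mem_univ _) hb

/-! ### The new circuits and their descriptions. -/

section Circuits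

variable (w m F : ℕ)

/-- The qubit `q` of the verifier. -/
abbrev sysQ (q : Fin (w + m)) : Fin (w + m + (w + F)) := Fin.castAdd (w + F) q

/-- The qubit of the second register that belongs to the witness qubit `p`. -/
abbrev partQ (p : Fin w) : Fin (w + m + (w + F)) := Fin.natAdd (w + m) (Fin.castAdd F p)

/-- The flag `c`. -/
abbrev flagQ (c : Fin F) : Fin (w + m + (w + F)) := Fin.natAdd (w + m) (Fin.natAdd w c)

theorem sysQ_ne_partQ (q : Fin (w + m)) (p : Fin w) : sysQ w m F q ≠ partQ w m F p := by
  simp [Fin.ext_iff]; omega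

theorem sysQ_ne_flagQ (q : Fin (w + m)) (c : Fin F) : sysQ w m F q ≠ flagQ w m F c := by
  simp [Fin.ext_iff]; omega

/-- For `q < p`, a controlled NOT from the witness qubit `q` to its partner, after a Hadamard gate
if `had` is true. -/
def pairs (had : Bool) : (p : ℕ) → p ≤ w → Circuit (w + m + (w + F))
  | 0, _ => []
  | p + 1, h => (if had then [.hadamard (sysQ w m F (Fin.castAdd m ⟨p, h⟩))] else []) ++
      .cnot (sysQ w m F (Fin.castAdd m ⟨p, h⟩)) (partQ w m F ⟨p, h⟩) (sysQ_ne_partQ w m F _ _) ::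
        pairs had p (Nat.le_of_succ_le h)

theorem encode_pairs (had : Bool) (p : ℕ) (h : p ≤ w) :
    (pairs w m F had p h).encode = strPairs had (w + m) p := by
  induction p with
  | zero => rfl
  | succ p ih =>
    rw [pairs, Circuit.encode_append, Circuit.encode_cons, ih, strPairs]
    cases had <;> simp [Circuit.encode, Gate.encode, encodeQubit, strCnot, strH]

variable {w m F}

/-- A check whether the qubit `q` is `1`: the flag `c` is set if the flag `c + 1` is set and the
qubit is `1`. -/
def checkGate (q : Fin (w + m)) (c : ℕ) (h : c + 1 < F) : Gate (w + m + (w + F)) :=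
  .toffoli (sysQ w m F q) (flagQ w m F ⟨c + 1, h⟩) (flagQ w m F ⟨c, Nat.lt_of_succ_lt h⟩)
    (sysQ_ne_flagQ w m _ _ _) (sysQ_ne_flagQ w m _ _ _) (by simp)

/-- Checks whether the first `j` ancillas are `0`. -/
def checks (w m F : ℕ) (c : ℕ) : (j : ℕ) → j ≤ m → c + j < F → Circuit (w + m + (w + F))
  | 0, _, _ => []
  | j + 1, h, h' => .pauliX (sysQ w m F (Fin.natAdd w ⟨j, h⟩)) ::
      checkGate (Fin.natAdd w ⟨j, h⟩) (c + j) h' ::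
      .pauliX (sysQ w m F (Fin.natAdd w ⟨j, h⟩)) ::
      checks w m F c j (Nat.le_of_succ_le h) (Nat.lt_of_succ_lt h')

theorem encode_checkGate (q : Fin (w + m)) (c : ℕ) (h : c + 1 < F) :
    (checkGate q c h).encode = strToffoli q (w + m + w + c + 1) (w + m + w + c) := by
  simp [checkGate, Gate.encode, encodeQubit, strToffoli, add_assoc]

theorem encode_checks (c j : ℕ) (h : j ≤ m) (h' : c + j < F) :
    (checks w m F c j h h').encode = strChecks w (w + m + w + c) j := by
  induction j with
  | zero => rfl
  | succ j ih =>
    simp only [checks, Circuit.encode_cons, ih, strChecks, encode_checkGate]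
    simp [Gate.encode, encodeQubit, strX, add_assoc]

/-- One round of the amplification. -/
def round (C : Circuit (w + m)) (hN : 0 < w + m) (c : ℕ) (h : c + m + 1 < F) :
    Circuit (w + m + (w + F)) :=
  C.lift (w + F) ++ (checkGate ⟨0, hN⟩ (c + m) h :: (C.inv.lift (w + F) ++
    checks w m F c m le_rfl (Nat.lt_of_succ_lt h)))

theorem encode_round (C : Circuit (w + m)) (hN : 0 < w + m) (c : ℕ) (h : c + m + 1 < F) :
    (round C hN c h).encode = strRound w m (w + m + w + c) C.encode C.inv.encode := by
  simp only [round, Circuit.encode_append, Circuit.encode_cons, Circuit.encode_lift,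
    encode_checkGate, encode_checks, strRound, add_assoc]

/-- The last `i` rounds of the amplification. -/
def rounds (C : Circuit (w + m)) (hN : 0 < w + m) :
    (i : ℕ) → i * (m + 1) < F → Circuit (w + m + (w + F))
  | 0, _ => []
  | i + 1, h => round C hN (i * (m + 1)) (by rw [add_mul] at h; omega) ++
      rounds C hN i (by rw [add_mul] at h; omega)

theorem encode_rounds (C : Circuit (w + m)) (hN : 0 < w + m) (i : ℕ) (h : i * (m + 1) < F) :
    (rounds C hN i h).encode = strRounds w m (w + m + w) C.encode C.inv.encode i := by
  induction i with
  | zero => rfl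
  | succ i ih => rw [rounds, Circuit.encode_append, encode_round, ih, strRounds]

/-- The circuit that decides with maximally mixed witness. -/
def amplify (C : Circuit (w + m)) (hN : 0 < w + m) :
    Circuit (w + m + (w + ((w + 1) * (m + 1) + 1))) :=
  pairs w m _ true w le_rfl ++ (.pauliX (flagQ w m _ ⟨(w + 1) * (m + 1), Nat.lt_succ_self _⟩) ::
    (rounds C hN (w + 1) (Nat.lt_succ_self _) ++
      [.cnot (sysQ w m _ ⟨0, hN⟩) (flagQ w m _ 0) (sysQ_ne_flagQ w m _ _ _),
        .cnot (flagQ w m _ 0) (sysQ w m _ ⟨0, hN⟩) (sysQ_ne_flagQ w m _ _ _).symm]))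

theorem encode_amplify (C : Circuit (w + m)) (hN : 0 < w + m) :
    (amplify C hN).encode = strAmplify w m C.encode C.inv.encode := by
  simp only [amplify, Circuit.encode_append, Circuit.encode_cons, encode_pairs, encode_rounds,
    strAmplify]
  simp [Gate.encode, encodeQubit, strX, strCnot, add_assoc, Circuit.encode]

/-- The circuit that copies the witness and then runs the verifier. -/
def copyWitness (C : Circuit (w + m)) : Circuit (w + m + (w + 0)) :=
  pairs w m 0 false w le_rfl ++ C.lift (w + 0)

theorem encode_copyWitness (C : Circuit (w + m)) :
    (copyWitness C).encode = strPairs false (w + m) w ++ C.encode := by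
  rw [copyWitness, Circuit.encode_append, encode_pairs, Circuit.encode_lift]

end Circuits

end SBQPMerlin

namespace SBQPMerlin

open scoped ComplexOrder
open Function Matrix

variable {w m F : ℕ}

theorem pad_self (y : Fin w → Bool) : pad w y = y := by
  funext p
  simp [pad]

theorem pad_castAdd (y : Fin w → Bool) (p : Fin w) : pad (w + m) y (Fin.castAdd m p) = y p := by
  simp [pad]

/-! ### The copied witness -/

/-- The CNOTs run downwards from index `p - 1`, so the invariant `hv` says that partners from `p` on
already hold their copy while those below are still 0. -/
theorem toOp_pairs_false_mulVec (y₀ : Fin w → Bool) {p : ℕ} (hp : p ≤ w)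
    {v : (Fin (w + m + (w + F)) → Bool) → ℂ}
    (hv : ∀ a y f, v (Fin.append a (Fin.append y f)) = if a = pad (w + m) y₀ ∧
      (∀ q : Fin w, y q = if q.val < p then false else y₀ q) ∧ f = fun _ => false then 1 else 0)
    (a : Fin (w + m) → Bool) (y : Fin w → Bool) (f : Fin F → Bool) :
    (Circuit.toOp (pairs w m F false p hp) *ᵥ v) (Fin.append a (Fin.append y f)) =
      if a = pad (w + m) y₀ ∧ y = y₀ ∧ f = fun _ => false then 1 else 0 := by
  induction p generalizing v with
  | zero =>
    rw [pairs, toOp_nil_mulVec, hv]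
    simp [funext_iff]
  | succ p ih =>
    simp only [pairs, Bool.false_eq_true, if_false, List.nil_append]
    rw [toOp_cons_mulVec]
    refine ih (Nat.le_of_succ_le hp) fun a y f => ?_
    rw [toOp_cnot_mulVec]
    simp only [update_append_castAdd, update_append_natAdd, Fin.append_left, Fin.append_right, hv]
    refine if_congr (and_congr_right fun ha => and_congr_left fun _ => ?_) rfl rfl
    subst ha
    rw [pad_castAdd]
    refine forall_congr' fun q => ?_
    by_cases hq : q = ⟨p, hp⟩
    · subst hq; simp
    · have : q.val ≠ p := fun h => hq (Fin.ext h)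
      rw [update_of_ne hq]
      have e : q.val < p + 1 ↔ q.val < p := by omega
      simp only [e]

/-- The copy of the witness survives to the end, so final vectors of distinct strings are orthogonal
within each outcome and the off-diagonal entries vanish. -/
theorem acceptOp_copyWitness (hN : 0 < w + m) (C : Circuit (w + m)) :
    acceptOp w (copyWitness C) = diagonal fun y => acceptOp w C y y := by
  have hcol : ∀ (y₀ : Fin w → Bool) a y f,
      (Circuit.toOp (copyWitness C) *ᵥ Pi.single (pad _ y₀) 1) (Fin.append a (Fin.append y f)) =
        if y = y₀ ∧ f = fun _ => false then (C.toOp *ᵥ Pi.single (pad _ y₀) 1) a else 0 := by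
    intro y₀ a y f
    rw [copyWitness, toOp_append_mulVec, Circuit.toOp_lift_mulVec]
    have hv : ∀ a y (f : Fin 0 → Bool),
        (Pi.single (pad (w + m + (w + 0)) y₀) 1 : (Fin (w + m + (w + 0)) → Bool) → ℂ)
          (Fin.append a (Fin.append y f)) = if a = pad (w + m) y₀ ∧
      (∀ q : Fin w, y q = if q.val < w then false else y₀ q) ∧ f = fun _ => false then 1 else 0 := by
      intro a y f
      rw [Pi.single_apply]
      refine if_congr ?_ rfl rfl
      have e : (fun _ : Fin (w + 0) => false) = Fin.append (fun _ : Fin w => false)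
          fun _ : Fin 0 => false := by
        funext p
        refine Fin.addCases (fun p => ?_) (fun p => p.elim0) p
        exact (Fin.append_left (fun _ : Fin w => false) (fun _ : Fin 0 => false) p).symm
      rw [pad_add (Nat.le_add_right w m), e, append_inj, append_inj]
      refine and_congr_right fun _ => and_congr_left fun _ => ?_
      simp [funext_iff]
    simp only [toOp_pairs_false_mulVec y₀ le_rfl hv]
    split_ifs with h
    · congr 2
      funext a'
      simp [Pi.single_apply, h]
    · have : (fun a' => if a' = pad (w + m) y₀ ∧ y = y₀ ∧ f = fun _ => false then (1 : ℂ) else 0) =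
          0 := by
        funext a'
        rw [if_neg fun h' => h h'.2, Pi.zero_apply]
      rw [this, mulVec_zero, Pi.zero_apply]
  ext z y
  rw [acceptOp_apply, sum_append, diagonal_apply]
  simp only [sum_append (N := w) (R := 0), Fintype.sum_unique, hcol, outputBit_append hN]
  have hf : ∀ f : Fin 0 → Bool, f = fun _ => false := fun f => Subsingleton.elim _ _
  split_ifs with hzy
  · subst hzy
    rw [acceptOp_apply]
    refine Finset.sum_congr rfl fun a _ => ?_
    rw [Finset.sum_eq_single z]
    · simp [outputBit, hN, hf]
    · intro y _ hy
      simp [hy]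
    · intro h
      exact absurd (Finset.mem_univ _) h
  · refine Finset.sum_eq_zero fun a _ => Finset.sum_eq_zero fun y' _ => ?_
    by_cases h₁ : y' = z
    · have h₂ : y' ≠ y := fun h => hzy (h₁.symm.trans h)
      simp [h₂]
    · simp [h₁]

/-! ### The amplified verifier -/

/-- The entries `1/√2` of the Hadamard matrix. -/
noncomputable def invSqrtTwo : ℂ := 1 / ((Real.sqrt 2 : ℝ) : ℂ)

theorem normSq_invSqrtTwo : Complex.normSq invSqrtTwo = 1 / 2 := by
  rw [invSqrtTwo, map_div₀, Complex.normSq_ofReal]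
  simp

/-- In the invariant `hv`, the qubit pairs from `p` on are already maximally entangled and those
below are still 0. Each further pair contributes one factor `invSqrtTwo`. -/
theorem toOp_pairs_true_mulVec {p : ℕ} (hp : p ≤ w) (k : ℂ)
    {v : (Fin (w + m + (w + F)) → Bool) → ℂ}
    (hv : ∀ a b y f, v (Fin.append (Fin.append a b) (Fin.append y f)) =
      if (∀ q : Fin w, if q.val < p then a q = false ∧ y q = false else y q = a q) ∧
        (b = fun _ => false) ∧ f = fun _ => false then k else 0)
    (a : Fin w → Bool) (b : Fin m → Bool) (y : Fin w → Bool) (f : Fin F → Bool) :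
    (Circuit.toOp (pairs w m F true p hp) *ᵥ v) (Fin.append (Fin.append a b) (Fin.append y f)) =
      if y = a ∧ (b = fun _ => false) ∧ f = fun _ => false then k * invSqrtTwo ^ p else 0 := by
  induction p generalizing v k with
  | zero =>
    rw [pairs, toOp_nil_mulVec, hv]
    simp [funext_iff]
  | succ p ih =>
    simp only [pairs, if_true, List.cons_append, List.nil_append]
    rw [toOp_cons_mulVec, toOp_cons_mulVec]
    rw [ih (Nat.le_of_succ_le hp) (invSqrtTwo * k), pow_succ']
    · congr 1
      ring
    intro a b y f
    rw [toOp_cnot_mulVec]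
    simp only [update_append_castAdd, update_append_natAdd, Fin.append_left, Fin.append_right]
    simp only [Gate.toOp, onQubit_mulVec, update_append_castAdd, Fin.append_left, Fintype.sum_bool,
      hv]
    -- Before its Hadamard gate the qubit `p` is 0, so the summand in which it was 1 vanishes.
    have h₁ : ¬ ∀ q : Fin w, if q.val < p + 1 then update a ⟨p, hp⟩ true q = false ∧
        update y ⟨p, hp⟩ (xor (y ⟨p, hp⟩) (a ⟨p, hp⟩)) q = false else
        update y ⟨p, hp⟩ (xor (y ⟨p, hp⟩) (a ⟨p, hp⟩)) q = update a ⟨p, hp⟩ true q := by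
      intro h
      simpa using h ⟨p, hp⟩
    have h₂ : (∀ q : Fin w, if q.val < p + 1 then update a ⟨p, hp⟩ false q = false ∧
        update y ⟨p, hp⟩ (xor (y ⟨p, hp⟩) (a ⟨p, hp⟩)) q = false else
        update y ⟨p, hp⟩ (xor (y ⟨p, hp⟩) (a ⟨p, hp⟩)) q = update a ⟨p, hp⟩ false q) ↔
        ∀ q : Fin w, if q.val < p then a q = false ∧ y q = false else y q = a q := by
      refine forall_congr' fun q => ?_
      by_cases hq : q = ⟨p, hp⟩
      · subst hq; simp
      · have : q.val ≠ p := fun h => hq (Fin.ext h)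
        have e : q.val < p + 1 ↔ q.val < p := by omega
        simp only [update_of_ne hq, e]
    have h₃ : hadamardMatrix (a ⟨p, hp⟩) false = invSqrtTwo := by
      simp [hadamardMatrix, invSqrtTwo]
    rw [if_neg fun h => h₁ h.1, h₃]
    simp only [h₂]
    simp

/-- The vector `v` consists of the vector `φ` on the verifier and its second register, with all
flags from `c` on set and the others not set, and of a part in which the flags up to `c` are not
set. -/
structure FlagInv (c : ℕ) (φ : Matrix (Fin (w + m) → Bool) (Fin w → Bool) ℂ)
    (v : (Fin (w + m + (w + F)) → Bool) → ℂ) : Prop where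
  zero : ∀ a y (f : Fin F → Bool) (j : Fin F), j.val < c → f j = true →
    v (Fin.append a (Fin.append y f)) = 0
  good : ∀ a y (f : Fin F → Bool) (h : c < F), f ⟨c, h⟩ = true →
    v (Fin.append a (Fin.append y f)) = if f = fun j => decide (c ≤ j.val) then φ a y else 0

variable {c : ℕ} {φ : Matrix (Fin (w + m) → Bool) (Fin w → Bool) ℂ}
  {v : (Fin (w + m + (w + F)) → Bool) → ℂ}

theorem FlagInv.congr {φ' : Matrix (Fin (w + m) → Bool) (Fin w → Bool) ℂ} (h : FlagInv c φ v)
    (e : ∀ a y, φ a y = φ' a y) : FlagInv c φ' v := by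
  have : φ = φ' := Matrix.ext e
  rwa [← this]

theorem FlagInv.lift (h : FlagInv c φ v) (C : Circuit (w + m)) :
    FlagInv c (C.toOp * φ) (Circuit.toOp (C.lift (w + F)) *ᵥ v) where
  zero a y f j hj hf := by
    rw [Circuit.toOp_lift_mulVec]
    have : (fun a' => v (Fin.append a' (Fin.append y f))) = 0 :=
      funext fun a' => h.zero a' y f j hj hf
    rw [this, mulVec_zero, Pi.zero_apply]
  good a y f hc hf := by
    rw [Circuit.toOp_lift_mulVec]
    have := fun a' => h.good a' y f hc hf
    simp only [this]
    split_ifs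
    · rfl
    · exact congrFun (mulVec_zero _) a

theorem FlagInv.pauliX (h : FlagInv c φ v) (q : Fin (w + m)) :
    FlagInv c (fun a y => φ (update a q (!a q)) y) ((Gate.pauliX (sysQ w m F q)).toOp *ᵥ v) where
  zero a y f j hj hf := by
    simp only [toOp_pauliX_mulVec, update_append_castAdd, Fin.append_left]
    exact h.zero _ y f j hj hf
  good a y f hc hf := by
    simp only [toOp_pauliX_mulVec, update_append_castAdd, Fin.append_left]
    exact h.good _ y f hc hf

/-- Flag `c` was nowhere set before, so afterwards it is set exactly where flag `c + 1` is set and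
the check succeeds. Failed branches keep flag `c` at 0 and play no further role. -/
theorem FlagInv.checkGate (q : Fin (w + m)) (hc : c + 1 < F) (h : FlagInv (c + 1) φ v) :
    FlagInv c (fun a y => if a q then φ a y else 0) ((checkGate q c hc).toOp *ᵥ v) := by
  have e : ∀ a y f, ((SBQPMerlin.checkGate q c hc).toOp *ᵥ v) (Fin.append a (Fin.append y f)) =
      v (Fin.append a (Fin.append y (update f ⟨c, Nat.lt_of_succ_lt hc⟩
        (xor (f ⟨c, Nat.lt_of_succ_lt hc⟩) (a q && f ⟨c + 1, hc⟩))))) := by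
    intro a y f
    rw [SBQPMerlin.checkGate, toOp_toffoli_mulVec]
    simp only [update_append_natAdd, Fin.append_left, Fin.append_right]
  constructor
  · intro a y f j hj hf
    rw [e]
    refine h.zero _ _ _ j (by omega) ?_
    rw [update_of_ne (by simp [Fin.ext_iff]; omega), hf]
  · intro a y f hc' hf
    rw [e, hf]
    cases hq : a q && f ⟨c + 1, hc⟩
    -- The gate leaves flag `c` alone here, so it was set before as well, where the vector vanishes.
    · rw [h.zero _ _ _ ⟨c, hc'⟩ (by simp) (by simp)]
      split_ifs with h₁ h₂
      · rw [h₁] at hq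
        simp [h₂] at hq
      · rfl
      · rfl
    · rw [Bool.and_eq_true] at hq
      rw [h.good _ _ _ hc (by simp [hq.2]), if_pos hq.1]
      refine if_congr ?_ rfl rfl
      constructor
      · intro h'
        funext j
        have hj := congrFun h' j
        by_cases hjc : j = ⟨c, hc'⟩
        · subst hjc; simp [hf]
        · rw [update_of_ne hjc] at hj
          have : j.val ≠ c := fun h => hjc (Fin.ext h)
          rw [hj]
          simp only [decide_eq_decide]
          omega
      · rintro rfl
        funext j
        by_cases hjc : j = ⟨c, hc'⟩
        · subst hjc; simp
        · have : j.val ≠ c := fun h => hjc (Fin.ext h)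
          rw [update_of_ne hjc]
          simp only [decide_eq_decide]
          omega

/-- Conjugation by `X` turns a check for 1 into a check for 0. -/
theorem FlagInv.checks {j : ℕ} (hj : j ≤ m) (hF : c + j < F) (h : FlagInv (c + j) φ v) :
    FlagInv c (fun a y => if ∀ i : Fin m, i.val < j → a (Fin.natAdd w i) = false then φ a y else 0)
      (Circuit.toOp (checks w m F c j hj hF) *ᵥ v) := by
  induction j generalizing v φ with
  | zero => simpa [SBQPMerlin.checks, toOp_nil_mulVec] using h
  | succ j ih =>
    rw [SBQPMerlin.checks, toOp_cons_mulVec, toOp_cons_mulVec, toOp_cons_mulVec]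
    have h₁ := ((h.pauliX (Fin.natAdd w ⟨j, hj⟩)).checkGate (c := c + j)
      (Fin.natAdd w ⟨j, hj⟩) hF).pauliX (Fin.natAdd w ⟨j, hj⟩)
    refine (ih (Nat.le_of_succ_le hj) (Nat.lt_of_succ_lt hF) h₁).congr fun a y => ?_
    simp only [update_self, update_idem, Bool.not_not, update_eq_self, Bool.not_eq_true',
      ← ite_and]
    refine if_congr ?_ rfl rfl
    constructor
    · rintro ⟨h₁, h₂⟩ i hi
      rcases Nat.lt_succ_iff_lt_or_eq.1 hi with hi | hi
      · exact h₁ i hi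
      · have : i = ⟨j, hj⟩ := Fin.ext hi
        rw [this, h₂]
    · intro h'
      exact ⟨fun i hi => h' i (by omega), h' ⟨j, hj⟩ (by simp)⟩

/-- E E† for the isometry E = `embedding w (w + m)` is the projection onto ancillas 0, the effect of
a successful ancilla check. -/
theorem embedding_mul_conjTranspose_mul :
    embedding w (w + m) * (embedding w (w + m))ᴴ * φ = fun a y =>
      if ∀ i : Fin m, a (Fin.natAdd w i) = false then φ a y else 0 := by
  have e : embedding w (w + m) * (embedding w (w + m))ᴴ =
      diagonal fun a => if ∀ i : Fin m, a (Fin.natAdd w i) = false then 1 else 0 := by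
    ext a a'
    obtain ⟨⟨a, b⟩, rfl⟩ := (Fin.appendEquiv w m).surjective a
    obtain ⟨⟨a', b'⟩, rfl⟩ := (Fin.appendEquiv w m).surjective a'
    simp only [Fin.appendEquiv, Equiv.coe_fn_mk, mul_apply, conjTranspose_apply, embedding,
      of_apply, pad_add le_rfl, pad_self, append_inj, diagonal_apply, Fin.append_right, ite_and,
      ite_mul, one_mul, zero_mul, Finset.sum_ite_eq, Finset.mem_univ, if_true, apply_ite star,
      star_one, star_zero, ← funext_iff (g := fun _ => false)]
    by_cases hb : b = fun _ => false <;> by_cases hb' : b' = fun _ => false <;>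
      by_cases ha : a = a' <;> simp_all [eq_comm]
  rw [e]
  ext a y
  rw [diagonal_mul]
  split_ifs <;> simp

/-- One round of the verifier on its own register. -/
noncomputable def roundOp (C : Circuit (w + m)) : Op (w + m) :=
  embedding w (w + m) * (embedding w (w + m))ᴴ * (C.toOpᴴ * (acceptProj (w + m) * C.toOp))

theorem FlagInv.round (C : Circuit (w + m)) (hN : 0 < w + m) (hF : c + m + 1 < F)
    (h : FlagInv (c + m + 1) φ v) :
    FlagInv c (roundOp C * φ) (Circuit.toOp (round C hN c hF) *ᵥ v) := by
  rw [SBQPMerlin.round, toOp_append_mulVec, toOp_cons_mulVec, toOp_append_mulVec]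
  refine ((((h.lift C).checkGate ⟨0, hN⟩ hF).lift C.inv).checks le_rfl
    (Nat.lt_of_succ_lt hF)).congr ?_
  have e : (acceptProj (w + m) * (C.toOp * φ)) =
      fun a y => if a ⟨0, hN⟩ = true then (C.toOp * φ) a y else 0 := by
    ext a y
    rw [acceptProj, diagonal_mul, outputBit, dif_pos hN]
    split_ifs <;> simp
  rw [roundOp, Matrix.mul_assoc (_ * _), embedding_mul_conjTranspose_mul, Matrix.mul_assoc,
    Matrix.mul_assoc, e, Circuit.toOp_inv]
  intro a y
  simp

theorem FlagInv.rounds (C : Circuit (w + m)) (hN : 0 < w + m) {i : ℕ} (hF : i * (m + 1) < F)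
    (h : FlagInv (i * (m + 1)) φ v) :
    FlagInv 0 (roundOp C ^ i * φ) (Circuit.toOp (rounds C hN i hF) *ᵥ v) := by
  induction i generalizing v φ with
  | zero => simpa [SBQPMerlin.rounds, toOp_nil_mulVec] using h
  | succ i ih =>
    rw [SBQPMerlin.rounds, toOp_append_mulVec, pow_succ, Matrix.mul_assoc]
    refine ih _ (FlagInv.round C hN _ ?_)
    rwa [add_mul, one_mul, ← add_assoc] at h

/-- A round ends with the projection E E†, and E† U† Π U E is `acceptOp`; thus a round carries E to
E `acceptOp`. -/
theorem roundOp_pow_mul_embedding (C : Circuit (w + m)) (i : ℕ) :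
    roundOp C ^ i * embedding w (w + m) = embedding w (w + m) * acceptOp w C ^ i := by
  induction i with
  | zero => simp
  | succ i ih =>
    rw [pow_succ, Matrix.mul_assoc]
    have : roundOp C * embedding w (w + m) = embedding w (w + m) * acceptOp w C := by
      simp only [roundOp, acceptOp, Matrix.mul_assoc]
    rw [this, ← Matrix.mul_assoc, ih, Matrix.mul_assoc, pow_succ]

end SBQPMerlin

/-! ### The acceptance probability of the amplified circuit. -/

namespace SBQPMerlin

open scoped ComplexOrder
open Function Matrix

/-- Two of the three CNOTs of a swap suffice to bring the value of `t` to `s`. It moves the lowest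
flag to the output qubit. -/
theorem sum_normSq_cnot_cnot {N : ℕ} {s t : Fin N} (h : s ≠ t) (v : (Fin N → Bool) → ℂ) :
    ∑ i, (if i s then Complex.normSq
      ((Circuit.toOp [.cnot s t h, .cnot t s h.symm] *ᵥ v) i) else 0) =
      ∑ i, if i t then Complex.normSq (v i) else 0 := by
  have h₁ : Involutive fun i : Fin N → Bool => update i t (xor (i t) (i s)) := by
    intro i; simp [h]
  have h₂ : Involutive fun i : Fin N → Bool => update i s (xor (i s) (i t)) := by
    intro i; simp [h.symm]
  refine Eq.trans ?_ ((h₂.toPerm.trans h₁.toPerm).sum_comp fun i =>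
    if i t then Complex.normSq (v i) else 0)
  refine Finset.sum_congr rfl fun i _ => ?_
  rw [toOp_cons_mulVec, toOp_cons_mulVec, toOp_nil_mulVec, toOp_cnot_mulVec, toOp_cnot_mulVec]
  cases hs : i s <;> cases ht : i t <;> simp [h.symm, hs, ht]

theorem sum_normSq_eq_re_trace {ι κ : Type*} [Fintype ι] [Fintype κ] (A : Matrix ι κ ℂ) :
    ∑ i, ∑ j, Complex.normSq (A i j) = (Aᴴ * A).trace.re := by
  rw [Finset.sum_comm, trace, Complex.re_sum]
  refine Finset.sum_congr rfl fun j _ => ?_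
  rw [Matrix.diag_apply, mul_apply, Complex.re_sum]
  refine Finset.sum_congr rfl fun i _ => ?_
  rw [conjTranspose_apply, RCLike.star_def, ← Complex.normSq_eq_conj_mul_self, Complex.ofReal_re]

variable {w m : ℕ}

/-- The maximally entangled state, read as a matrix from the second register to the verifier, is a
multiple of the isometry `embedding`. The `X` sets the top flag and so starts the chain of checks.
-/
theorem flagInv_pairs {c : ℕ} :
    FlagInv c (invSqrtTwo ^ w • embedding w (w + m))
      ((Gate.pauliX (flagQ w m (c + 1) ⟨c, Nat.lt_succ_self c⟩)).toOp *ᵥ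
        (Circuit.toOp (pairs w m (c + 1) true w le_rfl) *ᵥ Pi.single (fun _ => false) 1)) := by
  have hv : ∀ a b y f, (Pi.single (fun _ => false) 1 : (Fin (w + m + (w + (c + 1))) → Bool) → ℂ)
      (Fin.append (Fin.append a b) (Fin.append y f)) =
      if (∀ q : Fin w, if q.val < w then a q = false ∧ y q = false else y q = a q) ∧
        (b = fun _ => false) ∧ f = fun _ => false then 1 else 0 := by
    intro a b y f
    have e : ∀ N R : ℕ, (fun _ : Fin (N + R) => false) =
        Fin.append (fun _ => false) fun _ => false := by
      intro N R
      funext p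
      refine Fin.addCases (fun p => ?_) (fun p => ?_) p <;> simp
    rw [Pi.single_apply]
    refine if_congr ?_ rfl rfl
    rw [e (w + m), e w, e w, append_inj, append_inj, append_inj]
    simp [funext_iff, forall_and]
    tauto
  have h := fun a b y f =>
    toOp_pairs_true_mulVec (F := c + 1) (m := m) (le_refl w) 1 hv a b y f
  constructor
  · intro a y f j hj hf
    obtain ⟨⟨a, b⟩, rfl⟩ := (Fin.appendEquiv w m).surjective a
    simp only [Fin.appendEquiv, Equiv.coe_fn_mk, toOp_pauliX_mulVec, update_append_natAdd, h]
    rw [if_neg]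
    rintro ⟨-, -, h⟩
    have := congrFun h j
    rw [update_of_ne (by simp [Fin.ext_iff]; omega), hf] at this
    exact absurd this (by simp)
  · intro a y f hc hf
    obtain ⟨⟨a, b⟩, rfl⟩ := (Fin.appendEquiv w m).surjective a
    simp only [Fin.appendEquiv, Equiv.coe_fn_mk, toOp_pauliX_mulVec, update_append_natAdd, h,
      Fin.append_right, hf, Matrix.smul_apply, embedding, of_apply, pad_add le_rfl, pad_self, append_inj,
      smul_eq_mul, mul_ite, mul_one, mul_zero, one_mul, ← ite_and]
    refine if_congr ?_ rfl rfl
    have : (update f ⟨c, Nat.lt_succ_self c⟩ (!true) = fun _ => false) ↔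
        f = fun j => decide (c ≤ j.val) := by
      simp only [funext_iff]
      refine forall_congr' fun j => ?_
      by_cases hj : j = ⟨c, hc⟩
      · subst hj; simp [hf]
      · have : ¬ c ≤ j.val := fun h =>
          hj (Fin.ext (le_antisymm (Nat.le_of_lt_succ j.isLt) h))
        rw [update_of_ne hj]
        simp [this]
    rw [this, eq_comm (a := y)]
    tauto

theorem FlagInv.sum_normSq {F : ℕ} {φ : Matrix (Fin (w + m) → Bool) (Fin w → Bool) ℂ}
    {v : (Fin (w + m + (w + (F + 1))) → Bool) → ℂ} (h : FlagInv 0 φ v) :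
    ∑ i, (if i (flagQ w m (F + 1) 0) then Complex.normSq (v i) else 0) =
      (φᴴ * φ).trace.re := by
  rw [← sum_normSq_eq_re_trace, sum_append]
  refine Finset.sum_congr rfl fun a _ => ?_
  rw [sum_append]
  refine Finset.sum_congr rfl fun y _ => ?_
  rw [Finset.sum_eq_single fun _ => true]
  · rw [h.good a y _ (Nat.succ_pos F) rfl]
    simp
  · intro f _ hf
    simp only [Fin.append_right]
    split_ifs with hf₀
    · rw [h.good a y f (Nat.succ_pos F) hf₀, if_neg (by simpa using hf), map_zero]
    · rfl
  · intro h
    exact absurd (Finset.mem_univ _) h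

/-- The accepting part is the matrix 2^(-w/2) E A^(w+1), with E isometric and A = `acceptOp w C`
Hermitian. Its squared Frobenius norm doubles the exponent. -/
theorem acceptProb_amplify (C : Circuit (w + m)) (hN : 0 < w + m) :
    acceptProb (amplify C hN) (zeroState _) =
      (1 / 2) ^ w * (acceptOp w C ^ (2 * (w + 1))).trace.re := by
  have hM := (posSemidef_acceptOp w C).isHermitian
  rw [zeroState, acceptProb_basisState]
  have ho : ∀ i : Fin (w + m + (w + ((w + 1) * (m + 1) + 1))) → Bool,
      outputBit i = i (sysQ w m _ ⟨0, hN⟩) := fun i => dif_pos (by omega)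
  simp only [ho, amplify, toOp_append_mulVec, toOp_cons_mulVec _ (_ ++ _)]
  rw [sum_normSq_cnot_cnot, (flagInv_pairs.rounds C hN (Nat.lt_succ_self _)).sum_normSq,
    Matrix.mul_smul, roundOp_pow_mul_embedding, conjTranspose_smul, Matrix.smul_mul, Matrix.mul_smul, smul_smul,
    conjTranspose_mul, Matrix.mul_assoc, ← Matrix.mul_assoc _ (embedding _ _),
    embedding_conjTranspose_mul_self (Nat.le_add_right w m), Matrix.one_mul,
    conjTranspose_pow, hM.eq, ← pow_add, ← two_mul, trace_smul, RCLike.star_def,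
    ← Complex.normSq_eq_conj_mul_self, map_pow, normSq_invSqrtTwo, smul_eq_mul,
    Complex.re_ofReal_mul]

end SBQPMerlin

/-! ### The three inclusions. -/

namespace SBQPMerlin

open scoped ComplexOrder
open Function Matrix

/-- A circuit, regarded as a circuit on an equal number of qubits. -/
def Circuit.cast {N N' : ℕ} (h : N = N') (C : Circuit N) : Circuit N' := h ▸ C

theorem Circuit.encode_cast {N N' : ℕ} (h : N = N') (C : Circuit N) :
    (C.cast h).encode = C.encode := by
  subst h; rfl

theorem acceptOp_cast {w N N' : ℕ} (h : N = N') (C : Circuit N) :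
    acceptOp w (C.cast h) = acceptOp w C := by
  subst h; rfl

theorem acceptProb_cast_zeroState {N N' : ℕ} (h : N = N') (C : Circuit N) :
    acceptProb (C.cast h) (zeroState N') = acceptProb C (zeroState N) := by
  subst h; rfl

/-- Uniformity sees only the descriptions, which do not record the size of the register, so idle
qubits and casts are harmless. -/
theorem Uniform.of_encode_eq {N N' : ℕ → ℕ} {Q : ∀ x : List Bool, Circuit (N x.length)}
    {Q' : ∀ x : List Bool, Circuit (N' x.length)} (hQ : Uniform Q)
    (h : ∀ x, (Q' x).encode = (Q x).encode) : Uniform Q' := by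
  unfold Uniform at hQ ⊢
  rwa [funext h]

theorem isState_basisState {w : ℕ} (y : Fin w → Bool) : IsState (basisState y) := by
  have e : basisState y = diagonal (Pi.single y 1) := by
    rw [diagonal_single, basisState]
  refine ⟨?_, by simp [basisState]⟩
  rw [e]
  exact PosSemidef.diagonal (Pi.single_nonneg.2 zero_le_one)

theorem trace_mul_basisState {w : ℕ} (M : Op w) (y : Fin w → Bool) :
    (M * basisState y).trace = M y y := by
  simp [basisState, trace_mul_single]

theorem re_trace_mul_of_eq_zero {w N : ℕ} (hw : w = 0) (C : Circuit N) {ξ : Op w}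
    (hξ : IsState ξ) : (acceptOp w C * ξ).trace.re = acceptProb C (zeroState N) := by
  subst hw
  obtain ⟨y⟩ : Nonempty (Fin 0 → Bool) := inferInstance
  have h : ξ y y = 1 := by
    rw [← hξ.2, trace, Fintype.sum_subsingleton _ y, Matrix.diag_apply]
  rw [acceptProb_zeroState C y, trace, Fintype.sum_subsingleton _ y, Matrix.diag_apply, mul_apply,
    Fintype.sum_subsingleton _ y, h, mul_one]

/-- The diagonal of a state is a probability distribution, so the trace is an average of the entries
of `d`. -/
theorem re_trace_diagonal_mul_le {w : ℕ} {d : (Fin w → Bool) → ℂ} {t : ℝ} (hd : ∀ y, (d y).re ≤ t)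
    {ξ : Op w} (hξ : IsState ξ) : (diagonal d * ξ).trace.re ≤ t := by
  have hre : ∀ y, 0 ≤ (ξ y y).re ∧ (ξ y y).im = 0 := by
    intro y
    have := Complex.nonneg_iff.1 (hξ.1.diag_nonneg (i := y))
    exact ⟨this.1, this.2.symm⟩
  have h₁ : ∑ y, (ξ y y).re = 1 := by
    rw [← Complex.re_sum]
    exact (congrArg Complex.re hξ.2).trans Complex.one_re
  calc (diagonal d * ξ).trace.re = ∑ y, (d y).re * (ξ y y).re := by
        rw [trace, Complex.re_sum]
        refine Finset.sum_congr rfl fun y _ => ?_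
        rw [Matrix.diag_apply, diagonal_mul, Complex.mul_re, (hre y).2, mul_zero, sub_zero]
    _ ≤ ∑ y, t * (ξ y y).re :=
        Finset.sum_le_sum fun y _ => mul_le_mul_of_nonneg_right (hd y) (hre y).1
    _ = t := by rw [← Finset.mul_sum, h₁, mul_one]

theorem SBQP_subset_QCMA_SBQP : SBQP ⊆ QCMA_SBQP := by
  rintro L ⟨m, r, Q, hQ, h⟩
  have e : ∀ n, m.eval n = (0 : Polynomial ℕ).eval n + m.eval n := by simp
  have hp : ∀ x (y : Fin ((0 : Polynomial ℕ).eval x.length) → Bool),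
      acceptProb ((Q x).cast (e _)) (tensor (basisState y) (zeroState _)) =
        acceptProb (Q x) (zeroState _) := by
    intro x y
    rw [acceptProb_tensor, acceptOp_cast,
      re_trace_mul_of_eq_zero Polynomial.eval_zero _ (isState_basisState y)]
  refine ⟨0, m, r, fun x => (Q x).cast (e _), hQ.of_encode_eq fun x => Circuit.encode_cast _ _,
    fun x => ⟨fun hx => ⟨fun _ => false, ?_⟩, fun hx y => ?_⟩⟩
  · rw [hp]
    exact (h x).1 hx
  · rw [hp]
    exact (h x).2 hx

theorem QCMA_SBQP_subset_QMA_SBQP : QCMA_SBQP ⊆ QMA_SBQP := by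
  rintro L ⟨w, m, r, Q, hQ, h⟩
  -- One idle ancilla is added so that qubit 0 exists even when `w` and `m` vanish.
  have hpos : ∀ n, 0 < w.eval n + (m.eval n + 1) := fun n => Nat.succ_pos _
  have e : ∀ n, w.eval n + (m.eval n + 1) + (w.eval n + 0) =
      w.eval n + (m + 1 + w).eval n := by
    intro n; simp; ring
  let Q₁ : ∀ x : List Bool, Circuit (w.eval x.length + (m.eval x.length + 1)) :=
    fun x => (Q x).lift 1
  let Q₂ : ∀ x : List Bool, Circuit (w.eval x.length + (m + 1 + w).eval x.length) :=
    fun x => (copyWitness (Q₁ x)).cast (e _)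
  have hop : ∀ x, acceptOp (w.eval x.length) (Q₂ x) =
      diagonal fun y => acceptOp (w.eval x.length) (Q x) y y := by
    intro x
    rw [acceptOp_cast, acceptOp_copyWitness (hpos _)]
    simp only [Q₁]
    rw [acceptOp_lift (Nat.le_add_right _ _)]
  simp only [acceptProb_tensor, trace_mul_basisState] at h
  refine ⟨w, m + 1 + w, r, Q₂, uniform_of_strPairs (w := w) (m := m + 1) hQ fun x => ?_,
    fun x => ⟨fun hx => ?_, fun hx ξ hξ => ?_⟩⟩
  · rw [Circuit.encode_cast, encode_copyWitness, Circuit.encode_lift]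
    simp
  · obtain ⟨y, hy⟩ := (h x).1 hx
    refine ⟨basisState y, isState_basisState y, ?_⟩
    rwa [acceptProb_tensor, trace_mul_basisState, hop, diagonal_apply_eq]
  · rw [acceptProb_tensor, hop]
    exact re_trace_diagonal_mul_le ((h x).2 hx) hξ

theorem QMA_SBQP_subset_SBQP : QMA_SBQP ⊆ SBQP := by
  rintro L ⟨w, m, r, Q, hQ, h⟩
  have hpos : ∀ n, 0 < w.eval n + (m.eval n + 1) := fun n => Nat.succ_pos _
  have e : ∀ n, w.eval n + (m.eval n + 1) +
      (w.eval n + ((w.eval n + 1) * (m.eval n + 1 + 1) + 1)) =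
      (w + (m + 1) + (w + ((w + 1) * (m + 1 + 1) + 1))).eval n := by
    intro n; simp
  let Q₁ : ∀ x : List Bool, Circuit (w.eval x.length + (m.eval x.length + 1)) :=
    fun x => (Q x).lift 1
  have hQ₁ : Uniform (N := fun n => w.eval n + (m.eval n + 1)) Q₁ :=
    hQ.of_encode_eq fun x => Circuit.encode_lift _
  have hop : ∀ x, acceptOp (w.eval x.length) (Q₁ x) = acceptOp (w.eval x.length) (Q x) :=
    fun x => acceptOp_lift (Nat.le_add_right _ _) _
  simp only [acceptProb_tensor] at h
  -- The new threshold is the old one to the power 2(w+1), times the factor 2^(-w) of the maximally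
  -- mixed witness.
  refine ⟨_, 2 * (w + 1) * r + w, fun x => (amplify (Q₁ x) (hpos _)).cast (e _),
    uniform_of_strAmplify (w := w) (m := m + 1) hQ₁ fun x => ?_,
    fun x => ⟨fun hx => ?_, fun hx => ?_⟩⟩
  · rw [Circuit.encode_cast, encode_amplify]
    simp
  all_goals
    rw [acceptProb_cast_zeroState, acceptProb_amplify, hop]
    have hM := posSemidef_acceptOp (w.eval x.length) (Q x)
    have hr : (2 * (w + 1) * r + w).eval x.length =
        w.eval x.length + r.eval x.length * (2 * (w.eval x.length + 1)) := by
      simp; ring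
    rw [hr]
  · obtain ⟨ψ, hψ, hx⟩ := (h x).1 hx
    rw [pow_add, pow_mul]
    gcongr
    exact pow_le_re_trace_pow hM hψ (by positivity) hx _
  · have := re_trace_pow_le hM ((h x).2 hx) (2 * (w.eval x.length + 1))
    refine (mul_le_mul_of_nonneg_left this (by positivity)).trans ?_
    rw [← mul_assoc, ← mul_pow, one_div_mul_cancel two_ne_zero, one_pow, one_mul, ← pow_mul]
    -- The 2^w eigenvalues have cancelled the factor 2^(-w). What remains is w + 2r(w+1) + 1 ≤
    -- 2(r+1)(w+1), which holds with w + 1 to spare.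
    exact pow_le_pow_of_le_one (by norm_num) (by norm_num) (by linarith)

end SBQPMerlin

theorem mainTheorem3 :
    SBQPMerlin.QCMA_SBQP = SBQPMerlin.QMA_SBQP ∧ SBQPMerlin.QMA_SBQP = SBQPMerlin.SBQP :=
  ⟨SBQPMerlin.QCMA_SBQP_subset_QMA_SBQP.antisymm
      (SBQPMerlin.QMA_SBQP_subset_SBQP.trans SBQPMerlin.SBQP_subset_QCMA_SBQP),
    SBQPMerlin.QMA_SBQP_subset_SBQP.antisymm
      (SBQPMerlin.SBQP_subset_QCMA_SBQP.trans SBQPMerlin.QCMA_SBQP_subset_QMA_SBQP)⟩
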